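/- Let $p\ge 2$, let $I\subseteq\mathbf R$ be an interval with non-empty interior, and let $S^p\subset\mathbf R^{1+p}$ be the unit sphere. All maps are $C^\infty$ (with one-sided derivatives at endpoints belonging to $I$). A *frontal curve* is a smooth map $f:I\to\mathbf R^{1+p}$ for which there is a smooth map $\tau:I\to S^p$, called a *unit tangential frame* of $f$, such that $f'(t)$ is a scalar multiple of $\tau(t)$ for every $t\in I$. A point $t_0\in I$ is an *inflection point* of $f$ if $\tau'(t_0)=0$ for some unit tangential frame $\tau$ of $f$. For integers $1\le a_1<\dots<a_{1+p}$, the curve $f$ is *of type* $(a_1,\dots,a_{1+p})$ at $t\in I$ if, for $i=1,\dots,1+p$, $$a_i=\min\{k\ge 1\mid \operatorname{rank}\,(f'(t),f''(t),\dots,f^{(k)}(t))=i\}.$$ Then there is an open dense subset $\mathcal O$ of the space $C^\infty(I,\mathbf R\times S^p)$ with the Whitney $C^\infty$ topology such that every frontal curve $f:I\to\mathbf R^{1+p}$ with $f'=a\tau$ for some $(a,\tau)\in\mathcal O$ (that is, every *generic* frontal curve) has no inflection points and is, at each point of $I$, of type $(1,2,\dots,p,1+p)$, $(1,2,\dots,p,2+p)$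 or $(2,3,\dots,1+p,2+p)$. -/

import Mathlib

open scoped ContDiff

namespace FrontalCurve

noncomputable section

/-- The Euclidean space `ℝ^{1+p}`. -/
abbrev Euc (p : ℕ) : Type := EuclideanSpace ℝ (Fin (1 + p))

/-- The unit sphere `S^p ⊆ ℝ^{1+p}`. -/
abbrev UnitSphere (p : ℕ) : Type := Metric.sphere (0 : Euc p) 1

/-- A map on `I ⊆ ℝ` as a map on the line with arbitrary values (here `0`) outside `I`.
It is used below only through its values on `I`. -/
def ext {I : Set ℝ} {F : Type*} [Zero F] (f : I → F) : ℝ → F :=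
  Function.extend Subtype.val f 0

/-- `f : I → F` is of class `C^∞` (one-sided derivatives at endpoints that belong to `I`). -/
def IsSmooth {I : Set ℝ} {F : Type*} [NormedAddCommGroup F] [NormedSpace ℝ F]
    (f : I → F) : Prop :=
  ContDiffOn ℝ ∞ (ext f) I

/-- The `k`-th derivative of `f : I → F` at `t ∈ I`. -/
def D {I : Set ℝ} {F : Type*} [NormedAddCommGroup F] [NormedSpace ℝ F]
    (k : ℕ) (f : I → F) (t : I) : F :=
  iteratedDerivWithin k (ext f) I t

/-- A map into the sphere, regarded as a map into `ℝ^{1+p}`. -/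
def toEuc {I : Set ℝ} {p : ℕ} (τ : I → UnitSphere p) : I → Euc p := fun t => (τ t : Euc p)

/-- The space `C^∞(I, ℝ × S^p)`. A map into the sphere is smooth iff it is smooth as a map into
the ambient Euclidean space. -/
structure SmoothPair (I : Set ℝ) (p : ℕ) where
  a : I → ℝ
  τ : I → UnitSphere p
  smooth_a : IsSmooth a
  smooth_τ : IsSmooth (toEuc τ)

/-- The `k`-jet of `(a, τ)` at `t`, in the coordinates
`J^k(I, ℝ × S^p) ⊆ J^k(I, ℝ × ℝ^{1+p}) = I × (ℝ × ℝ^{1+p})^{k+1}`: the point `t` and the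
derivatives of order `0, …, k`. -/
def SmoothPair.jet {I : Set ℝ} {p : ℕ} (k : ℕ) (g : SmoothPair I p) (t : I) :
    I × (Fin (k + 1) → ℝ × Euc p) :=
  (t, fun j => (D j g.a t, D j (toEuc g.τ) t))

/-- The Whitney `C^∞` topology: it is generated by the sets `{g | j^k g (I) ⊆ U}`, where `k` is a
natural number and `U` is an open set of the space of `k`-jets. (As `J^k(I, ℝ × S^p)` has the
subspace topology from `J^k(I, ℝ × ℝ^{1+p})`, open sets of the latter give the same sets.) -/
instance whitneyTopology (I : Set ℝ) (p : ℕ) : TopologicalSpace (SmoothPair I p) :=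
  TopologicalSpace.generateFrom
    {M | ∃ (k : ℕ) (U : Set (I × (Fin (k + 1) → ℝ × Euc p))),
      IsOpen U ∧ M = {g | ∀ t : I, g.jet k t ∈ U}}

/-- `τ : I → S^p` is a (smooth) unit tangential frame of `f`:
`f'(t)` is a scalar multiple of `τ(t)` for every `t`. -/
def IsTangentialFrame {I : Set ℝ} {p : ℕ} (f : I → Euc p) (τ : I → UnitSphere p) : Prop :=
  IsSmooth (toEuc τ) ∧ ∀ t : I, ∃ c : ℝ, D 1 f t = c • toEuc τ t

/-- Frontal curves `I → ℝ^{1+p}`. -/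
def IsFrontalCurve {I : Set ℝ} {p : ℕ} (f : I → Euc p) : Prop :=
  IsSmooth f ∧ ∃ τ : I → UnitSphere p, IsTangentialFrame f τ

/-- `t` is an inflection point of `f` if it is a singular point of some unit tangential frame. -/
def IsInflectionPoint {I : Set ℝ} {p : ℕ} (f : I → Euc p) (t : I) : Prop :=
  ∃ τ : I → UnitSphere p, IsTangentialFrame f τ ∧ D 1 (toEuc τ) t = 0

/-- The Wronskian matrix `W_k(f)(t)`, with columns `f'(t), f''(t), …, f^{(k)}(t)`. -/
def wronskian {I : Set ℝ} {p : ℕ} (k : ℕ) (f : I → Euc p) (t : I) :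
    Matrix (Fin (1 + p)) (Fin k) ℝ :=
  Matrix.of fun i j => D (j + 1) f t i

/-- `f` is of type `(b_1, …, b_{1+p})` at `t`: the `b_i` are positive and strictly increasing and
`b_i = min {k ≥ 1 | rank W_k(f)(t) = i}` for `1 ≤ i ≤ 1 + p` (the index of `b` starts at `0`). -/
def HasType {I : Set ℝ} {p : ℕ} (f : I → Euc p) (t : I) (b : Fin (1 + p) → ℕ) : Prop :=
  StrictMono b ∧ (∀ i, 1 ≤ b i) ∧
    ∀ i : Fin (1 + p), IsLeast {k : ℕ | 1 ≤ k ∧ (wronskian k f t).rank = i + 1} (b i)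

/-- `f` is a frontal curve with `f' = a τ` for some `(a, τ)` in the given set `O` of maps
`I → ℝ × S^p`. -/
def IsFrontalCurveFrom {I : Set ℝ} {p : ℕ} (O : Set (SmoothPair I p)) (f : I → Euc p) : Prop :=
  IsFrontalCurve f ∧ ∃ g ∈ O, ∀ t : I, D 1 f t = g.a t • toEuc g.τ t

/-- Generic frontal curves `I → ℝ^{1+p}` have the property `P`: there is an open dense set of
maps `(a, τ) : I → ℝ × S^p` such that each frontal curve `f` with `f' = a τ` for some member
`(a, τ)` of it has the property `P`. -/
def GenericFrontalCurvesSatisfy (I : Set ℝ) (p : ℕ) (P : (I → Euc p) → Prop) : Prop :=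
  ∃ O : Set (SmoothPair I p), IsOpen O ∧ Dense O ∧ ∀ f : I → Euc p, IsFrontalCurveFrom O f → P f

/-- The sequence `(1, 2, …, p, 1+p)`. -/
def typeRegular (p : ℕ) : Fin (1 + p) → ℕ := fun i => i + 1

/-- The sequence `(1, 2, …, p, 2+p)`. -/
def typeFlat (p : ℕ) : Fin (1 + p) → ℕ := fun i => if (i : ℕ) = p then p + 2 else i + 1

/-- The sequence `(2, 3, …, 1+p, 2+p)`. -/
def typeCuspidal (p : ℕ) : Fin (1 + p) → ℕ := fun i => i + 2

end

end FrontalCurve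

/-! For `f' = a τ` put `W = det(τ, τ', …, τ^(p))`. The generic condition is that `a W` has only
simple zeros on `I`: at each zero exactly one of `a`, `W` vanishes, and to first order. By Leibniz'
rule `det(f', …, f^(1+p)) = a^(1+p) W`, and the cases match the three types: regular where `a W ≠
0`, flat at zeros of `W`, cuspidal at zeros of `a` (`hasType_of_noDoubleZero`). Since the zeros of
`a` are isolated, the frame is unique up to sign, and `τ' = 0` would force `W = W' = 0` because `p ≥
2` (`not_isInflectionPoint_of_noDoubleZero`).

The condition is open because it confines the `(1+p)`-jet to an open set. Density rests on a
one-dimensional Sard argument (`NoDoubleZero.volume_perturbation`): if `e` has only simple zeros, so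
has `h + c e` for almost every `c`. A Wronskian is affine in a constant added to its first function,
with slope the Wronskian of the derivatives of the others. Induction therefore gives small `c i`
such that adding `c i * t^i / i!` leaves `W` with simple zeros only; one more constant handles the
product with `a`. As `W(l u) = l^m W(u)`, the perturbation may be scaled by a positive function `ρ`
and renormalized to the sphere without spoiling this. Choosing `ρ` with sufficiently small
derivatives (`exists_contDiff_pos_small`) keeps the new pair in a given Whitney neighbourhood, even
on non-compact `I`. -/

namespace FrontalCurve

/-! ### Wronskian determinants -/

/-- The Wronskian determinant, relative to the set `I`, of `m` real functions. -/
noncomputable def wronskianDet (I : Set ℝ) {m : ℕ} (v : Fin m → ℝ → ℝ) (t : ℝ) : ℝ :=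
  (Matrix.of fun i j : Fin m => iteratedDerivWithin j (v i) I t).det

/-- The Wronskian determinant with the last column differentiated once more. -/
noncomputable def wronskianDetNext (I : Set ℝ) {m : ℕ} (v : Fin m → ℝ → ℝ) (t : ℝ) : ℝ :=
  (Matrix.of fun i j : Fin m =>
    iteratedDerivWithin (if (j : ℕ) + 1 = m then m else j) (v i) I t).det

/-- `h` has no zero of multiplicity greater than one on `I`. -/
def NoDoubleZero (I : Set ℝ) (h : ℝ → ℝ) : Prop :=
  ∀ t ∈ I, h t = 0 → derivWithin h I t ≠ 0

theorem hasDerivWithinAt_det {n : Type*} [Fintype n] [DecidableEq n] {A : ℝ → Matrix n n ℝ}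
    {A' : Matrix n n ℝ} {s : Set ℝ} {t : ℝ}
    (h : ∀ i j, HasDerivWithinAt (fun x => A x i j) (A' i j) s t) :
    HasDerivWithinAt (fun x => (A x).det)
      (∑ j, ((A t).updateCol j (fun i => A' i j)).det) s t := by
  have h1 : HasDerivWithinAt (fun x => (A x).det)
      (∑ σ : Equiv.Perm n, (Equiv.Perm.sign σ : ℤ) •
        ∑ j, (∏ i ∈ Finset.univ.erase j, A t (σ i) i) • A' (σ j) j) s t := by
    simp only [Matrix.det_apply]
    refine HasDerivWithinAt.fun_sum fun σ _ => ?_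
    have := HasDerivWithinAt.fun_finsetProd (u := Finset.univ)
      (fun i _ => h (σ i) i)
    exact this.const_smul ((Equiv.Perm.sign σ : ℤ))
  convert! h1 using 1
  simp only [Matrix.det_apply, Finset.smul_sum]
  rw [Finset.sum_comm]
  refine Finset.sum_congr rfl fun σ _ => Finset.sum_congr rfl fun j _ => ?_
  rw [Units.smul_def, ← Finset.prod_erase_mul _ _ (Finset.mem_univ j)]
  congr 1
  rw [smul_eq_mul, Matrix.updateCol_self]
  congr 1
  exact Finset.prod_congr rfl fun i hi => Matrix.updateCol_ne (Finset.ne_of_mem_erase hi)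

theorem hasDerivWithinAt_iteratedDerivWithin {I : Set ℝ} (hI : UniqueDiffOn ℝ I) {f : ℝ → ℝ}
    (hf : ContDiffOn ℝ ∞ f I) (k : ℕ) {t : ℝ} (ht : t ∈ I) :
    HasDerivWithinAt (iteratedDerivWithin k f I) (iteratedDerivWithin (k + 1) f I t) I t := by
  rw [iteratedDerivWithin_succ]
  exact (hf.differentiableOn_iteratedDerivWithin (m := k) (by exact_mod_cast ENat.natCast_lt_top k)
    hI t ht).hasDerivWithinAt

/-- Differentiating any column but the last reproduces the next column, so only the last term of the
columnwise product rule survives. -/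
theorem hasDerivWithinAt_wronskianDet {I : Set ℝ} (hI : UniqueDiffOn ℝ I) {m : ℕ} (hm : 0 < m)
    {v : Fin m → ℝ → ℝ} (hv : ∀ i, ContDiffOn ℝ ∞ (v i) I) {t : ℝ} (ht : t ∈ I) :
    HasDerivWithinAt (wronskianDet I v) (wronskianDetNext I v t) I t := by
  obtain ⟨n, rfl⟩ : ∃ n, m = n + 1 := ⟨m - 1, by omega⟩
  have h := hasDerivWithinAt_det (s := I) (t := t)
    (A := fun x => Matrix.of fun i j : Fin (n + 1) => iteratedDerivWithin j (v i) I x)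
    (A' := Matrix.of fun i j : Fin (n + 1) => iteratedDerivWithin (j + 1) (v i) I t)
    (fun i j => hasDerivWithinAt_iteratedDerivWithin hI (hv i) j ht)
  convert! h using 1
  rw [Fin.sum_univ_castSucc, Finset.sum_eq_zero, zero_add]
  · unfold wronskianDetNext
    congr 1
    ext i j
    rcases Fin.eq_castSucc_or_eq_last j with ⟨j, rfl⟩ | rfl
    · rw [Matrix.updateCol_ne (Fin.castSucc_lt_last j).ne]
      have : (j : ℕ) ≠ n := j.2.ne
      simp [this]
    · simp
  · intro j _
    refine Matrix.det_zero_of_column_eq (i := j.castSucc) (j := j.succ) ?_ fun i => ?_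
    · exact (Fin.castSucc_lt_succ).ne
    · rw [Matrix.updateCol_self, Matrix.updateCol_ne (Fin.castSucc_lt_succ).ne']
      simp

theorem sum_range_succ_eq_sum_fin {m : ℕ} (j : Fin m) (F : ℕ → ℝ) :
    ∑ k ∈ Finset.range ((j : ℕ) + 1), F k = ∑ k : Fin m, if k ≤ j then F k else 0 := by
  have h1 : ∑ k : Fin m, (if k ≤ j then F k else 0)
      = ∑ k ∈ Finset.range m, if k ≤ (j : ℕ) then F k else 0 := by
    rw [Finset.sum_range]
    rfl
  rw [h1, ← Finset.sum_filter]
  congr 1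
  ext k
  simp only [Finset.mem_range, Finset.mem_filter]
  have := j.2
  omega

/-- Leibniz' rule factors the matrix of `v` as that of `u` times an upper triangular matrix with
diagonal entries `l t`. -/
theorem wronskianDet_mul {I : Set ℝ} (hI : UniqueDiffOn ℝ I) {m : ℕ}
    {v u : Fin m → ℝ → ℝ} {l : ℝ → ℝ} (hu : ∀ i, ContDiffOn ℝ ∞ (u i) I)
    (hl : ContDiffOn ℝ ∞ l I) (h : ∀ i, ∀ t ∈ I, v i t = l t * u i t) {t : ℝ} (ht : t ∈ I) :
    wronskianDet I v t = l t ^ m * wronskianDet I u t := by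
  let T : Matrix (Fin m) (Fin m) ℝ := Matrix.of fun k j =>
    if k ≤ j then ((j : ℕ).choose k : ℝ) * iteratedDerivWithin (j - k : ℕ) l I t else 0
  have hT : T.det = l t ^ m := by
    rw [Matrix.det_of_isUpperTriangular]
    · simp [T]
    · intro k j hkj
      have : ¬ k ≤ j := not_le.2 hkj
      simp [T, this]
  unfold wronskianDet
  rw [← hT, mul_comm, ← Matrix.det_mul]
  congr 1
  ext i j
  rw [Matrix.mul_apply, Matrix.of_apply,
    iteratedDerivWithin_congr (g := u i * l) (fun x hx => by simp [h i x hx, mul_comm]) ht,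
    iteratedDerivWithin_mul ht hI (((hu i).of_le (by exact_mod_cast le_top)) t ht)
      ((hl.of_le (by exact_mod_cast le_top)) t ht), sum_range_succ_eq_sum_fin]
  refine Finset.sum_congr rfl fun k _ => ?_
  simp only [T, Matrix.of_apply, mul_ite, mul_zero]
  split_ifs
  · ring
  · rfl

/-- At a zero of `l`, the shifted Wronskian determinant of `l u` is a multiple of that of `u`. -/
theorem det_shift_mul {I : Set ℝ} (hI : UniqueDiffOn ℝ I) {m : ℕ}
    {v u : Fin m → ℝ → ℝ} {l : ℝ → ℝ} (hu : ∀ i, ContDiffOn ℝ ∞ (u i) I)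
    (hl : ContDiffOn ℝ ∞ l I) (h : ∀ i, ∀ t ∈ I, v i t = l t * u i t) {t : ℝ} (ht : t ∈ I)
    (hlt : l t = 0) :
    (Matrix.of fun i j : Fin m => iteratedDerivWithin (j + 1) (v i) I t).det =
      (∏ j : Fin m, ((j : ℝ) + 1) * derivWithin l I t) * wronskianDet I u t := by
  -- The Leibniz term with `k = j + 1` carries the factor `l t = 0`; dropping it leaves a square
  -- triangular matrix with diagonal `(j + 1) l'`.
  let T : Matrix (Fin m) (Fin m) ℝ := Matrix.of fun k j =>
    if k ≤ j then (((j : ℕ) + 1).choose k : ℝ) * iteratedDerivWithin (j + 1 - k : ℕ) l I t else 0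
  have hT : T.det = ∏ j : Fin m, ((j : ℝ) + 1) * derivWithin l I t := by
    rw [Matrix.det_of_isUpperTriangular]
    · refine Finset.prod_congr rfl fun j _ => ?_
      simp [T, iteratedDerivWithin_one]
    · intro k j hkj
      have : ¬ k ≤ j := not_le.2 hkj
      simp [T, this]
  unfold wronskianDet
  rw [← hT, mul_comm, ← Matrix.det_mul]
  congr 1
  ext i j
  rw [Matrix.mul_apply, Matrix.of_apply,
    iteratedDerivWithin_congr (g := u i * l) (fun x hx => by simp [h i x hx, mul_comm]) ht,
    iteratedDerivWithin_mul ht hI (((hu i).of_le (by exact_mod_cast le_top)) t ht)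
      ((hl.of_le (by exact_mod_cast le_top)) t ht), Finset.sum_range_succ, Nat.sub_self,
    iteratedDerivWithin_zero, hlt, mul_zero, add_zero, sum_range_succ_eq_sum_fin]
  refine Finset.sum_congr rfl fun k _ => ?_
  simp only [T, Matrix.of_apply, mul_ite, mul_zero]
  split_ifs
  · ring
  · rfl

/-! ### Removing double zeros by a small constant -/

open Filter Topology in
-- Simple zeros are isolated, and a discrete subset of the line is countable.
theorem NoDoubleZero.countable_zeros {I : Set ℝ} {e : ℝ → ℝ} (he : DifferentiableOn ℝ e I)
    (h : NoDoubleZero I e) : {t | t ∈ I ∧ e t = 0}.Countable := by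
  set Z := {t | t ∈ I ∧ e t = 0}
  have hd : DiscreteTopology Z := by
    rw [discreteTopology_subtype_iff]
    intro t ht
    have h1 := (he t ht.1).hasDerivWithinAt.eventually_ne (c := 0) (h t ht.1 ht.2)
    rw [eventually_nhdsWithin_iff] at h1
    rw [← Filter.empty_mem_iff_bot, nhdsWithin, inf_assoc, inf_principal,
      ← nhdsWithin, ← Filter.eventually_false_iff_eq_bot.trans Filter.empty_mem_iff_bot.symm,
      eventually_nhdsWithin_iff]
    filter_upwards [h1] with x hx hx2
    exact hx ⟨hx2.2.1, hx2.1⟩ hx2.2.2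
  have : Countable Z := countable_of_Lindelof_of_discrete
  exact this.to_set

open MeasureTheory in
-- At a double zero with `e t ≠ 0`, `c` is a critical value of `-h/e`, and these form a null set by
-- Sard. If `e t = 0`, then `e' ≠ 0` forces `c = -h'/e'`, one value for each of countably many
-- points.
theorem NoDoubleZero.volume_perturbation {I : Set ℝ} {h e : ℝ → ℝ}
    (hh : DifferentiableOn ℝ h I) (he : DifferentiableOn ℝ e I) (hI : UniqueDiffOn ℝ I)
    (hne : NoDoubleZero I e) :
    volume {c : ℝ | ¬ NoDoubleZero I (fun t => h t + c * e t)} = 0 := by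
  set C := {t | t ∈ I ∧ e t ≠ 0 ∧ derivWithin h I t * e t = h t * derivWithin e I t}
  set Z := {t | t ∈ I ∧ e t = 0}
  have hC : volume ((fun t => -(h t / e t)) '' C) = 0 := by
    refine addHaar_image_eq_zero_of_det_fderivWithin_eq_zero (f' := fun _ => 0) volume ?_ ?_
    · intro t ht
      have h1 := ((hh t ht.1).hasDerivWithinAt.div (he t ht.1).hasDerivWithinAt ht.2.1).neg
      rw [ht.2.2, sub_self, zero_div, neg_zero] at h1
      have h2 := (h1.mono (fun x hx => hx.1 : C ⊆ I)).hasFDerivWithinAt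
      convert! h2 using 1
      ext
      simp
    · intro t _
      simp [ContinuousLinearMap.det]
  have hZ : volume ((fun t => -(derivWithin h I t / derivWithin e I t)) '' Z) = 0 :=
    ((hne.countable_zeros he).image _).measure_zero _
  refine measure_mono_null ?_ (measure_union_null hC hZ)
  intro c hc
  simp only [NoDoubleZero, not_forall, Set.mem_ofPred_eq, not_not] at hc
  obtain ⟨t, ht, h0, h1⟩ := hc
  have hd : derivWithin (fun t => h t + c * e t) I t
      = derivWithin h I t + c * derivWithin e I t :=
    ((hh t ht).hasDerivWithinAt.add ((he t ht).hasDerivWithinAt.const_mul c)).derivWithin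
      (hI t ht)
  rw [hd] at h1
  by_cases het : e t = 0
  · refine Or.inr ⟨t, ⟨ht, het⟩, ?_⟩
    have := hne t ht het
    field_simp
    linarith
  · refine Or.inl ⟨t, ⟨ht, het, ?_⟩, ?_⟩
    · linear_combination e t * h1 - derivWithin e I t * h0
    · field_simp
      linarith

theorem NoDoubleZero.exists_perturbation {I : Set ℝ} {h e : ℝ → ℝ}
    (hh : DifferentiableOn ℝ h I) (he : DifferentiableOn ℝ e I) (hI : UniqueDiffOn ℝ I)
    (hne : NoDoubleZero I e) {η : ℝ} (hη : 0 < η) :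
    ∃ c : ℝ, |c| < η ∧ NoDoubleZero I (fun t => h t + c * e t) := by
  by_contra! hcon
  have h1 : Set.Ioo (-η) η ⊆ {c : ℝ | ¬ NoDoubleZero I (fun t => h t + c * e t)} :=
    fun c hc => hcon c (abs_lt.2 hc)
  have h2 := MeasureTheory.measure_mono_null h1 (hne.volume_perturbation hh he hI)
  rw [Real.volume_Ioo, ENNReal.ofReal_eq_zero] at h2
  linarith

theorem NoDoubleZero.congr {I : Set ℝ} {h k : ℝ → ℝ} (hh : NoDoubleZero I h)
    (heq : Set.EqOn k h I) : NoDoubleZero I k := by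
  intro t ht h0
  rw [derivWithin_congr heq (heq ht)]
  exact hh t ht (by rw [← heq ht, h0])

theorem NoDoubleZero.mul_left {I : Set ℝ} (hI : UniqueDiffOn ℝ I) {h l : ℝ → ℝ}
    (hh : NoDoubleZero I h) (hd : DifferentiableOn ℝ h I) (hl : DifferentiableOn ℝ l I)
    (hl0 : ∀ t ∈ I, l t ≠ 0) : NoDoubleZero I (fun t => l t * h t) := by
  intro t ht h0
  have h1 : h t = 0 := (mul_eq_zero.1 h0).resolve_left (hl0 t ht)
  rw [((hl t ht).hasDerivWithinAt.fun_mul (hd t ht).hasDerivWithinAt).derivWithin (hI t ht), h1,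
    mul_zero, zero_add]
  exact mul_ne_zero (hl0 t ht) (hh t ht h1)

theorem differentiableOn_wronskianDet {I : Set ℝ} (hI : UniqueDiffOn ℝ I) {m : ℕ}
    {v : Fin m → ℝ → ℝ} (hv : ∀ i, ContDiffOn ℝ ∞ (v i) I) :
    DifferentiableOn ℝ (wronskianDet I v) I := by
  intro t ht
  exact (hasDerivWithinAt_det (s := I) (t := t)
    (A := fun x => Matrix.of fun i j : Fin m => iteratedDerivWithin j (v i) I x)
    (A' := Matrix.of fun i j : Fin m => iteratedDerivWithin (j + 1) (v i) I t)
    (fun i j => hasDerivWithinAt_iteratedDerivWithin hI (hv i) j ht)).differentiableWithinAt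

theorem wronskianDet_congr {I : Set ℝ} {m : ℕ} {v u : Fin m → ℝ → ℝ}
    (h : ∀ i, Set.EqOn (v i) (u i) I) {t : ℝ} (ht : t ∈ I) :
    wronskianDet I v t = wronskianDet I u t := by
  unfold wronskianDet
  congr 1
  ext i j
  exact iteratedDerivWithin_congr (h i) ht

/-- In an expansion along the first row only the zeroth entry sees the constant; its minor is the
Wronskian of the derivatives of `w`. -/
theorem wronskianDet_cons_add_const (I : Set ℝ) {m : ℕ} (f : ℝ → ℝ) (w : Fin m → ℝ → ℝ) (c t : ℝ) :
    wronskianDet I (Fin.cons (fun s => f s + c) w : Fin (m + 1) → ℝ → ℝ) t =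
      wronskianDet I (Fin.cons f w : Fin (m + 1) → ℝ → ℝ) t +
        c * wronskianDet I (fun i => derivWithin (w i) I) t := by
  unfold wronskianDet
  rw [Matrix.det_succ_row_zero, Matrix.det_succ_row_zero, Fin.sum_univ_succ, Fin.sum_univ_succ,
    add_right_comm]
  congr 1
  · simp only [Matrix.of_apply, Fin.cons_zero, Fin.val_zero, pow_zero, one_mul,
      iteratedDerivWithin_zero, add_mul]
    congr 2
    congr 1
    ext i j
    simp [iteratedDerivWithin_succ']
  · refine Finset.sum_congr rfl fun j _ => ?_
    congr 2
    · simp only [Matrix.of_apply, Fin.cons_zero]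
      have h1 : (fun s => f s + c) = fun s => c + f s := by
        ext
        ring
      rw [h1, iteratedDerivWithin_const_add (by simp)]

/-- The induction hypothesis is applied to the derivatives of all functions but the first. The
monomials `t^i / i!` are used because each is the derivative of the next, so the perturbations
integrate. The remaining constant `c0` then multiplies a Wronskian with simple zeros. -/
theorem exists_wronskianDet_noDoubleZero {I : Set ℝ} (hI : UniqueDiffOn ℝ I) {η : ℝ} (hη : 0 < η)
    (m : ℕ) (v : Fin m → ℝ → ℝ) (hv : ∀ i, ContDiffOn ℝ ∞ (v i) I) :
    ∃ c : Fin m → ℝ, (∀ i, |c i| < η) ∧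
      NoDoubleZero I
        (wronskianDet I (fun i t => v i t + c i * (t ^ (i : ℕ) / (i : ℕ).factorial))) := by
  induction m with
  | zero => exact ⟨0, fun i => i.elim0, fun t _ h => absurd h (by simp [wronskianDet])⟩
  | succ m ih =>
    obtain ⟨c, hc, hnd⟩ := ih (fun i => derivWithin (v i.succ) I) fun i =>
      (hv i.succ).derivWithin hI (by simp)
    set w : Fin m → ℝ → ℝ := fun i t =>
      v i.succ t + c i * (t ^ ((i : ℕ) + 1) / ((i : ℕ) + 1).factorial) with hw
    have hws : ∀ i, ContDiffOn ℝ ∞ (w i) I := fun i =>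
      (hv i.succ).add (ContDiff.contDiffOn (by fun_prop))
    have hwd : ∀ i, Set.EqOn (derivWithin (w i) I)
        (fun t => derivWithin (v i.succ) I t + c i * (t ^ (i : ℕ) / (i : ℕ).factorial)) I := by
      intro i t ht
      have h1 : HasDerivWithinAt (v i.succ) (derivWithin (v i.succ) I t) I t :=
        ((hv i.succ).differentiableOn (by simp) t ht).hasDerivWithinAt
      have h2 : HasDerivAt (fun t : ℝ => c i * (t ^ ((i : ℕ) + 1) / ((i : ℕ) + 1).factorial))
          (c i * (t ^ (i : ℕ) / (i : ℕ).factorial)) t := by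
        convert! ((hasDerivAt_pow ((i : ℕ) + 1) t).div_const
          (((i : ℕ) + 1).factorial : ℝ)).const_mul (c i) using 1
        rw [Nat.factorial_succ]
        push_cast
        field_simp
      exact (h1.add h2.hasDerivWithinAt).derivWithin (hI t ht)
    have hE : NoDoubleZero I (wronskianDet I fun i => derivWithin (w i) I) :=
      hnd.congr fun t ht => wronskianDet_congr hwd ht
    have hdw : ∀ i, ContDiffOn ℝ ∞ (derivWithin (w i) I) I := fun i =>
      (hws i).derivWithin hI (by simp)
    obtain ⟨c0, hc0, hnd0⟩ := hE.exists_perturbation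
      (h := wronskianDet I (Fin.cons (v 0) w : Fin (m + 1) → ℝ → ℝ))
      (differentiableOn_wronskianDet hI (Fin.cases (hv 0) hws))
      (differentiableOn_wronskianDet hI hdw) hI hη
    refine ⟨Fin.cons c0 c, Fin.cases hc0 hc, hnd0.congr fun t ht => ?_⟩
    refine Eq.trans ?_ (wronskianDet_cons_add_const I (v 0) w c0 t)
    congr 1
    ext i s
    refine Fin.cases ?_ (fun i => ?_) i <;> simp [hw]

/-! ### Ranks of the Wronskian matrix and types -/

/-- The derivatives of orders `c j + 1` form a basis, and the first `r` of them already occur among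
the columns of `wronskian k f t`, where order `c j + 1` has column index `c j`. -/
theorem le_rank_wronskian {I : Set ℝ} {p : ℕ} {f : I → Euc p} {t : I} {c : Fin (1 + p) → ℕ}
    (hdet : (Matrix.of fun i j : Fin (1 + p) => D (c j + 1) f t i).det ≠ 0) {k r : ℕ}
    (hr : r ≤ 1 + p) (hk : ∀ j : Fin (1 + p), (j : ℕ) < r → c j < k) :
    r ≤ (wronskian k f t).rank := by
  set A : Matrix (Fin (1 + p)) (Fin (1 + p)) ℝ := Matrix.of fun i j => D (c j + 1) f t i
  have h1 : LinearIndependent ℝ A.col :=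
    Matrix.linearIndependent_cols_iff_isUnit.2 ((Matrix.isUnit_iff_isUnit_det _).2 hdet.isUnit)
  have h2 : (A.submatrix id (Fin.castLE hr)).rank = r := by
    rw [← Matrix.rank_transpose]
    have h3 : LinearIndependent ℝ (A.submatrix id (Fin.castLE hr)).transpose.row :=
      h1.comp _ (Fin.castLE_injective hr)
    simpa using h3.rank_matrix
  rw [← h2]
  exact Matrix.rank_submatrix_le (wronskian k f t) id
    fun j : Fin r => (⟨c (Fin.castLE hr j), hk _ j.2⟩ : Fin k)

theorem rank_wronskian_le {I : Set ℝ} {p : ℕ} (f : I → Euc p) (t : I) (k : ℕ) :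
    (wronskian k f t).rank ≤ k := by
  simpa using (wronskian k f t).rank_le_card_width

theorem rank_wronskian_succ_le {I : Set ℝ} {p : ℕ} {f : I → Euc p} {t : I} (h : D 1 f t = 0)
    (k : ℕ) : (wronskian (k + 1) f t).rank ≤ k := by
  rw [Matrix.rank_eq_finrank_span_cols]
  have h1 : Set.range (wronskian (k + 1) f t).col ⊆
      insert 0 (Set.range fun j : Fin k => (wronskian (k + 1) f t).col j.succ) := by
    rintro _ ⟨j, rfl⟩
    refine Fin.cases (Or.inl ?_) (fun j => Or.inr ⟨j, rfl⟩) j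
    ext i
    simp [wronskian, h]
  calc _ ≤ _ := Submodule.finrank_mono (Submodule.span_mono h1)
    _ ≤ k := by
      rw [Submodule.span_insert_zero]
      refine (finrank_range_le_card (R := ℝ)
        fun j : Fin k => (wronskian (k + 1) f t).col j.succ).trans_eq (Fintype.card_fin k)

theorem hasType_regular {I : Set ℝ} {p : ℕ} {f : I → Euc p} {t : I}
    (hdet : (Matrix.of fun i j : Fin (1 + p) => D ((j : ℕ) + 1) f t i).det ≠ 0) :
    HasType f t (typeRegular p) := by
  refine ⟨fun i j hij => ?_, fun i => ?_, fun i => ⟨⟨?_, ?_⟩, ?_⟩⟩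
  · simpa [typeRegular] using hij
  · simp [typeRegular]
  · simp [typeRegular]
  · refine le_antisymm (rank_wronskian_le f t _) ?_
    exact le_rank_wronskian hdet (by omega) fun j hj => hj
  · rintro k ⟨-, hk⟩
    have := rank_wronskian_le f t k
    simp only [typeRegular]
    omega

theorem hasType_flat {I : Set ℝ} {p : ℕ} {f : I → Euc p} {t : I}
    (h0 : (Matrix.of fun i j : Fin (1 + p) => D ((j : ℕ) + 1) f t i).det = 0)
    (hdet : (Matrix.of fun i j : Fin (1 + p) =>
      D ((if (j : ℕ) + 1 = 1 + p then 1 + p else j) + 1) f t i).det ≠ 0) :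
    HasType f t (typeFlat p) := by
  refine ⟨fun i j hij => ?_, fun i => ?_, fun i => ⟨⟨?_, ?_⟩, ?_⟩⟩
  · have : (i : ℕ) < j := hij
    simp only [typeFlat]
    split_ifs <;> omega
  · simp only [typeFlat]
    split_ifs <;> omega
  · simp only [typeFlat]
    split_ifs <;> omega
  · refine le_antisymm ?_ (le_rank_wronskian hdet (by omega) fun j hj => ?_)
    · by_cases hi : (i : ℕ) = p
      · have := (wronskian (typeFlat p i) f t).rank_le_card_height
        rw [Fintype.card_fin] at this
        omega
      · have := rank_wronskian_le f t (typeFlat p i)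
        simpa [typeFlat, hi] using this
    · simp only [typeFlat]
      split_ifs <;> omega
  · rintro k ⟨-, hk⟩
    have := rank_wronskian_le f t k
    simp only [typeFlat]
    split_ifs with hi
    -- Reaching rank `1 + p` before order `p + 2` would make the square matrix `wronskian (1 + p) f
    -- t` invertible, against `h0`.
    · by_contra! hlt
      obtain rfl : k = 1 + p := by omega
      have hu : IsUnit (wronskian (1 + p) f t) := by
        rw [← Matrix.linearIndependent_cols_iff_isUnit, linearIndependent_iff_card_eq_finrank_span,
          Set.finrank, ← Matrix.rank_eq_finrank_span_cols, hk, hi, Fintype.card_fin, add_comm]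
      exact ((Matrix.isUnit_iff_isUnit_det _).1 hu).ne_zero h0
    · omega

theorem hasType_cuspidal {I : Set ℝ} {p : ℕ} {f : I → Euc p} {t : I} (h0 : D 1 f t = 0)
    (hdet : (Matrix.of fun i j : Fin (1 + p) => D ((j : ℕ) + 1 + 1) f t i).det ≠ 0) :
    HasType f t (typeCuspidal p) := by
  refine ⟨fun i j hij => ?_, fun i => ?_, fun i => ⟨⟨?_, ?_⟩, ?_⟩⟩
  · simpa [typeCuspidal] using hij
  · simp [typeCuspidal]
  · simp [typeCuspidal]
  · refine le_antisymm (rank_wronskian_succ_le h0 _) ?_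
    exact le_rank_wronskian (c := fun j => j + 1) hdet (by omega)
      fun j hj => by simp only [typeCuspidal]; omega
  · rintro k ⟨hk1, hk⟩
    obtain ⟨k, rfl⟩ : ∃ l, k = l + 1 := ⟨k - 1, by omega⟩
    have := rank_wronskian_succ_le h0 k
    simp only [typeCuspidal]
    omega

/-! ### Consequences of simple zeros of the degeneracy -/

theorem iteratedDerivWithin_euc_apply {I : Set ℝ} (hI : UniqueDiffOn ℝ I) {p : ℕ} {F : ℝ → Euc p}
    (hF : ContDiffOn ℝ ∞ F I) (k : ℕ) {t : ℝ} (ht : t ∈ I) (i : Fin (1 + p)) :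
    iteratedDerivWithin k (fun s => F s i) I t = iteratedDerivWithin k F I t i := by
  have h := (EuclideanSpace.proj i : Euc p →L[ℝ] ℝ).iteratedFDerivWithin_comp_left
    (hF t ht) hI ht (i := k) (by exact_mod_cast le_top)
  have h2 := congrArg (fun L => L fun _ => (1 : ℝ)) h
  simpa [iteratedDerivWithin_eq_iteratedFDerivWithin, Function.comp_def] using h2

theorem ext_apply {I : Set ℝ} {F : Type*} [Zero F] (f : I → F) (t : I) : ext f t = f t :=
  Subtype.val_injective.extend_apply f 0 t

/-- The coordinates of a map into the sphere, as functions on the line. -/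
noncomputable def coord {I : Set ℝ} {p : ℕ} (τ : I → UnitSphere p) (i : Fin (1 + p)) (s : ℝ) : ℝ :=
  ext (toEuc τ) s i

theorem contDiffOn_coord {I : Set ℝ} {p : ℕ} {τ : I → UnitSphere p} (h : IsSmooth (toEuc τ))
    (i : Fin (1 + p)) : ContDiffOn ℝ ∞ (coord τ i) I :=
  (EuclideanSpace.proj i : Euc p →L[ℝ] ℝ).contDiff.comp_contDiffOn h

/-- The function whose double zeros are excluded for generic frontal curves. -/
noncomputable def degeneracy {I : Set ℝ} {p : ℕ} (g : SmoothPair I p) (t : ℝ) : ℝ :=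
  ext g.a t * wronskianDet I (coord g.τ) t

theorem derivWithin_degeneracy {I : Set ℝ} (hI : UniqueDiffOn ℝ I) {p : ℕ} (g : SmoothPair I p)
    {t : ℝ} (ht : t ∈ I) :
    derivWithin (degeneracy g) I t = derivWithin (ext g.a) I t * wronskianDet I (coord g.τ) t +
      ext g.a t * wronskianDetNext I (coord g.τ) t :=
  ((ContDiffOn.differentiableOn g.smooth_a (by simp) t ht).hasDerivWithinAt.fun_mul
    (hasDerivWithinAt_wronskianDet hI (by omega) (contDiffOn_coord g.smooth_τ) ht)).derivWithin
    (hI t ht)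

theorem hasType_of_noDoubleZero {I : Set ℝ} (hI : UniqueDiffOn ℝ I) {p : ℕ} {f : I → Euc p}
    (hf : IsSmooth f) {g : SmoothPair I p} (hfg : ∀ t : I, D 1 f t = g.a t • toEuc g.τ t)
    (hg : NoDoubleZero I (degeneracy g)) (t : I) :
    HasType f t (typeRegular p) ∨ HasType f t (typeFlat p) ∨ HasType f t (typeCuspidal p) := by
  set A := ext g.a with hA
  set u := coord g.τ with hu
  have hAs : ContDiffOn ℝ ∞ A I := g.smooth_a
  have hus : ∀ i, ContDiffOn ℝ ∞ (u i) I := contDiffOn_coord g.smooth_τ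
  set v : Fin (1 + p) → ℝ → ℝ := fun i s => derivWithin (ext f) I s i with hv
  have hdf : ContDiffOn ℝ ∞ (derivWithin (ext f) I) I :=
    ContDiffOn.derivWithin hf hI (by simp)
  have hvs : ∀ i, ContDiffOn ℝ ∞ (v i) I := fun i =>
    (EuclideanSpace.proj i : Euc p →L[ℝ] ℝ).contDiff.comp_contDiffOn hdf
  have hvu : ∀ i, ∀ s ∈ I, v i s = A s * u i s := by
    intro i s hs
    have h1 := congrArg (fun x : Euc p => x i) (hfg ⟨s, hs⟩)
    simp only [D, iteratedDerivWithin_one] at h1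
    simpa [hv, hA, hu, coord, ← ext_apply] using h1
  have hD : ∀ k i, D (k + 1) f t i = iteratedDerivWithin k (v i) I t := by
    intro k i
    rw [iteratedDerivWithin_euc_apply hI hdf k t.2, D, iteratedDerivWithin_succ']
  have hw : Set.EqOn (wronskianDet I v) (fun s => A s ^ (1 + p) * wronskianDet I u s) I :=
    fun s hs => wronskianDet_mul hI hus hAs hvu hs
  have hgt := hg t t.2
  rw [derivWithin_degeneracy hI g t.2] at hgt
  by_cases hAt : A t = 0
  · have h2 := hgt (by simp [degeneracy, ← hA, hAt])
    rw [← hA, hAt, zero_mul, add_zero] at h2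
    refine Or.inr (Or.inr (hasType_cuspidal ?_ ?_))
    · rw [hfg, ← ext_apply g.a, ← hA, hAt, zero_smul]
    · simp only [hD]
      rw [det_shift_mul hI hus hAs hvu t.2 hAt]
      refine mul_ne_zero (Finset.prod_ne_zero_iff.2 fun j _ => mul_ne_zero (by positivity) ?_) ?_
      · exact left_ne_zero_of_mul h2
      · exact right_ne_zero_of_mul h2
  by_cases hut : wronskianDet I u t = 0
  · have h2 := hgt (by simp [degeneracy, ← hu, hut])
    rw [← hu, hut, mul_zero, zero_add] at h2
    refine Or.inr (Or.inl (hasType_flat ?_ ?_))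
    · simp only [hD]
      exact (hw t.2).trans (by simp [hut])
    · simp only [hD]
      -- Two derivatives of `a^(1+p) W` are compared; at a zero of `W` the product rule leaves
      -- `a^(1+p) W'`.
      have h3 := (hasDerivWithinAt_wronskianDet hI (by omega) hvs t.2).congr
        (fun s hs => (hw hs).symm) (hw t.2).symm
      have h4 := ((hAs.differentiableOn (by simp) t t.2).hasDerivWithinAt.fun_pow (1 + p)).fun_mul
        (hasDerivWithinAt_wronskianDet hI (by omega) hus t.2)
      have h5 := (hI t t.2).eq_deriv _ h3 h4
      rw [hut, mul_zero, zero_add] at h5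
      change wronskianDetNext I v t ≠ 0
      rw [h5]
      exact mul_ne_zero (pow_ne_zero _ hAt) (right_ne_zero_of_mul h2)
  · refine Or.inl (hasType_regular ?_)
    simp only [hD]
    exact (hw t.2).trans_ne (mul_ne_zero (pow_ne_zero _ hAt) hut)

open Filter Topology in
theorem not_isInflectionPoint_of_noDoubleZero {I : Set ℝ} (hI : UniqueDiffOn ℝ I) {p : ℕ}
    (hp : 2 ≤ p) {f : I → Euc p} {g : SmoothPair I p}
    (hfg : ∀ t : I, D 1 f t = g.a t • toEuc g.τ t)
    (hg : NoDoubleZero I (degeneracy g)) (t : I) : ¬ IsInflectionPoint f t := by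
  rintro ⟨σ, ⟨hσ, hfσ⟩, h0⟩
  set x := ext (toEuc g.τ) with hx
  set y := ext (toEuc σ) with hy
  have hxs : ContDiffOn ℝ ∞ x I := g.smooth_τ
  have hys : ContDiffOn ℝ ∞ y I := hσ
  have hnorm : ∀ (τ : I → UnitSphere p) (s : ℝ), s ∈ I → ‖ext (toEuc τ) s‖ = 1 := by
    intro τ s hs
    have := ext_apply (toEuc τ) ⟨s, hs⟩
    simp only at this
    rw [this]
    simp [toEuc]
  -- The factor between the two frames; it has square `1`, hence zero derivative.
  set θ : ℝ → ℝ := fun s => inner ℝ (x s) (y s) with hθ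
  have hθs : ContDiffOn ℝ ∞ θ I := hxs.inner ℝ hys
  have hparallel : ∀ s ∈ I, x s = θ s • y s := by
    have hne : ∀ s ∈ I, ext g.a s ≠ 0 → x s = θ s • y s := by
      intro s hs ha
      obtain ⟨c, hc⟩ := hfσ ⟨s, hs⟩
      rw [hfg, ← ext_apply g.a, ← ext_apply (toEuc g.τ), ← ext_apply (toEuc σ)] at hc
      have hxc : x s = ((ext g.a s)⁻¹ * c) • y s := by
        rw [mul_smul, ← hc, smul_smul, inv_mul_cancel₀ ha, one_smul]
      have hθc : θ s = (ext g.a s)⁻¹ * c := by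
        simp only [hθ]
        rw [hxc, real_inner_smul_left, real_inner_self_eq_norm_sq, hy, hnorm σ s hs]
        simp
      rw [hθc, ← hxc]
    intro s hs
    by_cases ha : ext g.a s = 0
    -- Zeros of `a` are simple, hence isolated, so proportionality of the frames extends to them by
    -- continuity.
    · have hda : derivWithin (ext g.a) I s ≠ 0 := by
        have := hg s hs (by simp [degeneracy, ha])
        rw [derivWithin_degeneracy hI g hs, ha, zero_mul, add_zero] at this
        exact left_ne_zero_of_mul this
      have h1 : ∀ᶠ z in 𝓝[I \ {s}] s, ext g.a z ≠ 0 :=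
        (ContDiffOn.differentiableOn g.smooth_a (by simp) s hs).hasDerivWithinAt.eventually_ne hda
      have hbot : (𝓝[I \ {s}] s).NeBot := by
        have := accPt_principal_iff_nhdsWithin.1 (hI s hs).accPt
        exact this
      have hmono : 𝓝[I \ {s}] s ≤ 𝓝[I] s := nhdsWithin_mono s Set.sdiff_subset
      have hlim1 : Tendsto x (𝓝[I \ {s}] s) (𝓝 (x s)) := (hxs.continuousOn s hs).mono_left hmono
      have hlim2 : Tendsto (fun z => θ z • y z) (𝓝[I \ {s}] s) (𝓝 (θ s • y s)) :=
        ((hθs.continuousOn.smul hys.continuousOn) s hs).mono_left hmono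
      refine tendsto_nhds_unique_of_eventuallyEq hlim1 hlim2 ?_
      filter_upwards [h1, self_mem_nhdsWithin] with z hz hzI
      exact hne z hzI.1 hz
    · exact hne s hs ha
  have hsq : Set.EqOn (fun s => θ s ^ 2) (fun _ => 1) I := by
    intro s hs
    have h1 : ‖x s‖ = ‖θ s • y s‖ := by rw [← hparallel s hs]
    rw [norm_smul, hx, hy, hnorm _ s hs, hnorm _ s hs, mul_one, Real.norm_eq_abs] at h1
    change θ s ^ 2 = 1
    rw [← sq_abs, ← h1, one_pow]
  have hθd := (hθs.differentiableOn (by simp) t t.2).hasDerivWithinAt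
  have hyd := (hys.differentiableOn (by simp) t t.2).hasDerivWithinAt
  have hθ0 : derivWithin θ I t = 0 := by
    have h1 := (hθd.fun_pow 2).derivWithin (hI t t.2)
    rw [derivWithin_congr hsq (hsq t.2), derivWithin_fun_const] at h1
    have h2 : θ t ≠ 0 := fun h => by simpa [h] using hsq t.2
    simpa [h2] using h1.symm
  have hy0 : derivWithin y I t = 0 := by
    simpa [D, iteratedDerivWithin_one] using h0
  have hx0 : derivWithin x I t = 0 := by
    rw [derivWithin_congr hparallel (hparallel t t.2),
      (hθd.fun_smul hyd).derivWithin (hI t t.2), hθ0, hy0]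
    simp
  have hcol : ∀ i, iteratedDerivWithin 1 (coord g.τ i) I t = 0 := by
    intro i
    refine (iteratedDerivWithin_euc_apply hI hxs 1 t.2 i).trans ?_
    rw [iteratedDerivWithin_one, hx0]
    simp
  have hw0 : wronskianDet I (coord g.τ) t = 0 := by
    refine Matrix.det_eq_zero_of_column_eq_zero (⟨1, by omega⟩ : Fin (1 + p)) fun i => ?_
    simpa using hcol i
  have hw1 : wronskianDetNext I (coord g.τ) t = 0 := by
    -- For `p ≥ 2` the column `τ'` is not the last one, so it is untouched by the extra derivative.
    refine Matrix.det_eq_zero_of_column_eq_zero (⟨1, by omega⟩ : Fin (1 + p)) fun i => ?_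
    have : ¬ (1 + 1 = 1 + p) := by omega
    simpa [this] using hcol i
  refine hg t t.2 (by simp [degeneracy, hw0]) ?_
  rw [derivWithin_degeneracy hI g t.2, hw0, hw1]
  simp

/-! ### Positive smooth functions with small derivatives -/

theorem exists_bound_iteratedFDeriv {f : ℝ → ℝ} (hf : ContDiff ℝ ∞ f) (hc : HasCompactSupport f)
    (j : ℕ) : ∃ C : ℝ, 0 ≤ C ∧ ∀ x, ‖iteratedFDeriv ℝ j f x‖ ≤ C := by
  obtain ⟨C, hC⟩ := (hc.iteratedFDeriv (𝕜 := ℝ) j).exists_bound_of_continuous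
    (hf.continuous_iteratedFDeriv (m := j) (by exact_mod_cast le_top))
  exact ⟨C, (norm_nonneg _).trans (hC 0), hC⟩

/-- A smooth function that is positive on `I` and whose derivatives of order at most `K` are
dominated by prescribed local bounds. -/
theorem exists_contDiff_pos_small {I : Set ℝ} (K : ℕ) (δ : ℝ → ℝ) (hδ : ∀ t ∈ I, 0 < δ t) :
    ∃ ρ : ℝ → ℝ, ContDiff ℝ ∞ ρ ∧ (∀ t ∈ I, 0 < ρ t) ∧
      ∀ t ∈ I, ∃ s ∈ I, |t - s| < δ s ∧ ∀ k ≤ K, |iteratedDeriv k ρ t| < δ s := by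
  rcases I.eq_empty_or_nonempty with rfl | hne
  · exact ⟨0, contDiff_const, by simp, by simp⟩
  obtain ⟨T, hTI, hTc, hcov⟩ := TopologicalSpace.countable_cover_nhdsWithin
    (s := I) (f := fun x => Metric.ball x (δ x / 3))
    fun x hx => mem_nhdsWithin_of_mem_nhds (Metric.ball_mem_nhds x (by linarith [hδ x hx]))
  have hTne : T.Nonempty := by
    obtain ⟨x, hx⟩ := hne
    obtain ⟨y, hy, -⟩ := Set.mem_iUnion₂.1 (hcov hx)
    exact ⟨y, hy⟩
  obtain ⟨e, rfl⟩ := hTc.exists_eq_range hTne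
  have heI : ∀ n, e n ∈ I := fun n => hTI ⟨n, rfl⟩
  have hδe : ∀ n, 0 < δ (e n) := fun n => hδ _ (heI n)
  -- The radii satisfy `1/3 < 1/2 < 1`: the bumps are positive on the covering balls and supported
  -- well inside the balls of radius `δ (e n)`.
  let b : ∀ n, ContDiffBump (e n) := fun n =>
    ⟨δ (e n) / 3, δ (e n) / 2, by linarith [hδe n], by linarith [hδe n]⟩
  choose C hC0 hC using fun n j => exists_bound_iteratedFDeriv (b n).contDiff
    (b n).hasCompactSupport j
  let d : ℕ → ℝ := fun n => (Finset.range (n + 1)).inf' ⟨0, by simp⟩ fun i => min (δ (e i)) 1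
  have hd0 : ∀ n, 0 < d n := fun n =>
    (Finset.lt_inf'_iff _).2 fun i _ => lt_min (hδe i) one_pos
  have hd : ∀ n i, i ≤ n → d n ≤ min (δ (e i)) 1 := fun n i hi =>
    Finset.inf'_le _ (Finset.mem_range.2 (by omega))
  -- Orders up to `n` make the series smooth, each order being controlled from some index on; orders
  -- up to `K` are controlled from the first term, for the final estimate.
  let M : ℕ → ℝ := fun n => 1 + ∑ j ∈ Finset.range (max n K + 1), C n j
  have hM : ∀ n, 0 < M n := fun n =>
    add_pos_of_pos_of_nonneg one_pos (Finset.sum_nonneg fun j _ => hC0 n j)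
  have hCM : ∀ n j, j ≤ max n K → C n j ≤ M n := fun n j hj =>
    (Finset.single_le_sum (f := C n) (s := Finset.range (max n K + 1)) (fun j _ => hC0 n j)
      (Finset.mem_range.2 (by omega))).trans (by simp [M])
  let c : ℕ → ℝ := fun n => (1 / 2) ^ (n + 2) * d n / M n
  have hc0 : ∀ n, 0 < c n := fun n => div_pos (mul_pos (by positivity) (hd0 n)) (hM n)
  let ψ : ℕ → ℝ → ℝ := fun n x => c n * b n x
  have hψ : ∀ n, ContDiff ℝ ∞ (ψ n) := fun n => contDiff_const.mul (b n).contDiff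
  have hbound : ∀ n j x, j ≤ max n K → ‖iteratedFDeriv ℝ j (ψ n) x‖ ≤ (1 / 2) ^ (n + 2) * d n := by
    intro n j x hj
    have h1 : iteratedFDeriv ℝ j (ψ n) x = c n • iteratedFDeriv ℝ j (b n) x :=
      iteratedFDeriv_const_smul_apply (f := b n) (a := c n) (((b n).contDiff (n := j)).contDiffAt)
    rw [h1, norm_smul, Real.norm_of_nonneg (hc0 n).le]
    calc c n * _ ≤ c n * M n :=
          mul_le_mul_of_nonneg_left ((hC n j x).trans (hCM n j hj)) (hc0 n).le
      _ = _ := div_mul_cancel₀ _ (hM n).ne'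
  have hbound1 : ∀ n j x, j ≤ max n K → ‖iteratedFDeriv ℝ j (ψ n) x‖ ≤ (1 / 2) ^ (n + 2) :=
    fun n j x hj => (hbound n j x hj).trans <| mul_le_of_le_one_right (by positivity)
      ((hd n n le_rfl).trans (min_le_right _ _))
  have hgeom : HasSum (fun n : ℕ => (1 / 2 : ℝ) ^ (n + 2)) (1 / 2) := by
    convert! hasSum_geometric_two.mul_left (1 / 4 : ℝ) using 1
    · ext n
      ring
    · norm_num
  have hvsum := hgeom.summable
  refine ⟨fun x => ∑' n, ψ n x, ?_, ?_, ?_⟩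
  · refine contDiff_tsum_of_eventually (N := ⊤) (v := fun _ n => (1 / 2 : ℝ) ^ (n + 2)) hψ
      (fun _ _ => hvsum) fun k _ => ?_
    rw [Nat.cofinite_eq_atTop]
    filter_upwards [Filter.eventually_ge_atTop k] with n hn x
    exact hbound1 n k x (le_max_of_le_left hn)
  · intro t ht
    have hs : Summable fun n => ψ n t := by
      refine hvsum.of_norm_bounded fun n => ?_
      simpa using hbound1 n 0 t (by simp)
    obtain ⟨_, ⟨n, rfl⟩, hn⟩ := Set.mem_iUnion₂.1 (hcov ht)
    refine hs.tsum_pos (fun n => mul_nonneg (hc0 n).le (b n).nonneg) n ?_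
    refine mul_pos (hc0 n) ((b n).pos_of_mem_ball ?_)
    have : dist t (e n) < δ (e n) / 3 := hn
    change dist t (e n) < δ (e n) / 2
    linarith [hδe n]
  · intro t ht
    have hex : ∃ n, |t - e n| < δ (e n) := by
      obtain ⟨_, ⟨n, rfl⟩, hn⟩ := Set.mem_iUnion₂.1 (hcov ht)
      have : dist t (e n) < δ (e n) / 3 := hn
      exact ⟨n, by rw [← Real.dist_eq]; linarith [hδe n]⟩
    classical
    -- Bumps before the first index `n₀` have supports missing `t`; later ones are bounded through
    -- `d n ≤ d n₀ ≤ δ (e n₀)`, with weights of total `1/2`.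
    set n₀ := Nat.find hex with hn₀
    refine ⟨e n₀, heI n₀, Nat.find_spec hex, fun k hk => ?_⟩
    have hsum : iteratedFDeriv ℝ k (fun x => ∑' n, ψ n x) t = ∑' n, iteratedFDeriv ℝ k (ψ n) t := by
      rw [iteratedFDeriv_tsum (N := (K : ℕ∞)) (v := fun _ n => (1 / 2 : ℝ) ^ (n + 2))
        (fun n => (hψ n).of_le (by exact_mod_cast le_top)) (fun _ _ => hvsum)
        (fun j n x hj => hbound1 n j x (le_max_of_le_right (by exact_mod_cast hj)))
        (by exact_mod_cast hk)]
    have hterm : ∀ n, ‖iteratedFDeriv ℝ k (ψ n) t‖ ≤ (1 / 2) ^ (n + 2) * d n₀ := by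
      intro n
      rcases lt_or_ge n n₀ with hn | hn
      · have hz : iteratedFDeriv ℝ k (ψ n) t = 0 := by
          by_contra hne0
          have h1 : t ∈ tsupport (ψ n) :=
            support_iteratedFDeriv_subset (𝕜 := ℝ) k (Function.mem_support.2 hne0)
          have h2 : t ∈ tsupport (b n) := closure_mono (Function.support_mul_subset_right _ _) h1
          rw [(b n).tsupport_eq, Metric.mem_closedBall, Real.dist_eq] at h2
          have h3 := Nat.find_min hex hn
          change |t - e n| ≤ δ (e n) / 2 at h2
          linarith [hδe n]
        rw [hz, norm_zero]
        exact mul_nonneg (by positivity) (hd0 _).le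
      · refine (hbound n k t (le_max_of_le_right hk)).trans ?_
        refine mul_le_mul_of_nonneg_left ?_ (by positivity)
        refine Finset.inf'_mono _ ?_ _
        intro i hi
        simp only [Finset.mem_range] at hi ⊢
        omega
    rw [← Real.norm_eq_abs, ← norm_iteratedFDeriv_eq_norm_iteratedDeriv, hsum]
    calc _ ≤ 1 / 2 * d n₀ := tsum_of_norm_bounded (hgeom.mul_right (d n₀)) hterm
      _ < d n₀ := by linarith [hd0 n₀]
      _ ≤ δ (e n₀) := (hd n₀ n₀ le_rfl).trans (min_le_left _ _)

/-! ### Convergence of jets -/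

open Filter Topology

/-- Along the filter `l`, the derivatives of order at most `K` of `F i` at `T i` tend to those of
`f` at `t₀`. -/
def JetTendsto {ι : Type*} (l : Filter ι) (I : Set ℝ) (K : ℕ) (T : ι → ℝ) (F : ι → ℝ → ℝ)
    (t₀ : ℝ) (f : ℝ → ℝ) : Prop :=
  ∀ k ≤ K, Tendsto (fun i => iteratedDerivWithin k (F i) I (T i)) l
    (𝓝 (iteratedDerivWithin k f I t₀))

namespace JetTendsto

variable {ι : Type*} {l : Filter ι} {I : Set ℝ} {K : ℕ} {T : ι → ℝ} {F G : ι → ℝ → ℝ} {t₀ : ℝ}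
  {f g : ℝ → ℝ}

theorem const (hI : UniqueDiffOn ℝ I) (hT : ∀ i, T i ∈ I) (ht₀ : t₀ ∈ I)
    (h : Tendsto T l (𝓝 t₀)) (hf : ContDiffOn ℝ ∞ f I) :
    JetTendsto l I K T (fun _ => f) t₀ f := fun k _ =>
  (hf.continuousOn_iteratedDerivWithin (m := k) (by exact_mod_cast le_top) hI t₀ ht₀).tendsto.comp
    (tendsto_nhdsWithin_iff.2 ⟨h, Eventually.of_forall hT⟩)

theorem congr (hT : ∀ i, T i ∈ I) (ht₀ : t₀ ∈ I) (h : JetTendsto l I K T F t₀ f)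
    (hF : ∀ i, Set.EqOn (G i) (F i) I) (hf : Set.EqOn g f I) : JetTendsto l I K T G t₀ g := by
  intro k hk
  rw [iteratedDerivWithin_congr hf ht₀]
  exact (h k hk).congr fun i => (iteratedDerivWithin_congr (hF i) (hT i)).symm

theorem mono {K' : ℕ} (h : JetTendsto l I K T F t₀ f) (hK : K' ≤ K) :
    JetTendsto l I K' T F t₀ f := fun k hk => h k (hk.trans hK)

theorem add (hI : UniqueDiffOn ℝ I) (hT : ∀ i, T i ∈ I) (ht₀ : t₀ ∈ I)
    (hF : ∀ i, ContDiffOn ℝ ∞ (F i) I) (hG : ∀ i, ContDiffOn ℝ ∞ (G i) I)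
    (hf : ContDiffOn ℝ ∞ f I) (hg : ContDiffOn ℝ ∞ g I)
    (h₁ : JetTendsto l I K T F t₀ f) (h₂ : JetTendsto l I K T G t₀ g) :
    JetTendsto l I K T (fun i s => F i s + G i s) t₀ (fun s => f s + g s) := by
  intro k hk
  have hle : ∀ {q : ℝ → ℝ}, ContDiffOn ℝ ∞ q I → ContDiffOn ℝ k q I :=
    fun hq => hq.of_le (by exact_mod_cast le_top)
  rw [iteratedDerivWithin_fun_add ht₀ hI (hle hf t₀ ht₀) (hle hg t₀ ht₀)]
  refine ((h₁ k hk).add (h₂ k hk)).congr fun i => ?_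
  rw [iteratedDerivWithin_fun_add (hT i) hI (hle (hF i) _ (hT i)) (hle (hG i) _ (hT i))]

theorem mul (hI : UniqueDiffOn ℝ I) (hT : ∀ i, T i ∈ I) (ht₀ : t₀ ∈ I)
    (hF : ∀ i, ContDiffOn ℝ ∞ (F i) I) (hG : ∀ i, ContDiffOn ℝ ∞ (G i) I)
    (hf : ContDiffOn ℝ ∞ f I) (hg : ContDiffOn ℝ ∞ g I)
    (h₁ : JetTendsto l I K T F t₀ f) (h₂ : JetTendsto l I K T G t₀ g) :
    JetTendsto l I K T (fun i s => F i s * G i s) t₀ (fun s => f s * g s) := by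
  intro k hk
  have hle : ∀ {q : ℝ → ℝ}, ContDiffOn ℝ ∞ q I → ContDiffOn ℝ k q I :=
    fun hq => hq.of_le (by exact_mod_cast le_top)
  have h := fun {q r : ℝ → ℝ} {s : ℝ} (hs : s ∈ I) (hq : ContDiffOn ℝ ∞ q I)
    (hr : ContDiffOn ℝ ∞ r I) => iteratedDerivWithin_mul hs hI (hle hq s hs) (hle hr s hs)
  change Tendsto (fun i => iteratedDerivWithin k (F i * G i) I (T i)) l
    (𝓝 (iteratedDerivWithin k (f * g) I t₀))
  rw [h ht₀ hf hg]
  refine (tendsto_finsetSum _ fun j hj => ?_).congr fun i => (h (hT i) (hF i) (hG i)).symm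
  have hj' := Finset.mem_range.1 hj
  exact ((h₁ j (by omega)).const_mul _).mul (h₂ (k - j) (by omega))

theorem sum {α : Type*} (A : Finset α) {F : α → ι → ℝ → ℝ} {f : α → ℝ → ℝ}
    (hI : UniqueDiffOn ℝ I) (hT : ∀ i, T i ∈ I) (ht₀ : t₀ ∈ I)
    (hF : ∀ a i, ContDiffOn ℝ ∞ (F a i) I) (hf : ∀ a, ContDiffOn ℝ ∞ (f a) I)
    (h : ∀ a, JetTendsto l I K T (F a) t₀ (f a)) :
    JetTendsto l I K T (fun i s => ∑ a ∈ A, F a i s) t₀ (fun s => ∑ a ∈ A, f a s) := by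
  intro k hk
  have hle : ∀ {q : ℝ → ℝ}, ContDiffOn ℝ ∞ q I → ContDiffOn ℝ k q I :=
    fun hq => hq.of_le (by exact_mod_cast le_top)
  rw [iteratedDerivWithin_fun_sum ht₀ hI fun a _ => hle (hf a) t₀ ht₀]
  refine (tendsto_finsetSum A fun a _ => h a k hk).congr fun i => ?_
  rw [iteratedDerivWithin_fun_sum (hT i) hI fun a _ => hle (hF a i) _ (hT i)]

theorem derivWithin (h : JetTendsto l I (K + 1) T F t₀ f) :
    JetTendsto l I K T (fun i => derivWithin (F i) I) t₀ (derivWithin f I) := by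
  intro k hk
  simpa only [iteratedDerivWithin_succ'] using h (k + 1) (by omega)

theorem succ (h₀ : Tendsto (fun i => F i (T i)) l (𝓝 (f t₀)))
    (h : JetTendsto l I K T (fun i => _root_.derivWithin (F i) I) t₀ (_root_.derivWithin f I)) :
    JetTendsto l I (K + 1) T F t₀ f := by
  rintro (_ | k) hk
  · simpa using h₀
  · simpa only [iteratedDerivWithin_succ'] using h k (by omega)

/-- The coefficients of a perturbation are only bounded, not convergent; the smallness comes from
`ρ`. -/
theorem bounded_const_mul {c : ι → ℝ} (hc : ∀ i, |c i| ≤ 1)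
    (h : JetTendsto l I K T F t₀ fun _ => 0) :
    JetTendsto l I K T (fun i s => c i * F i s) t₀ fun _ => 0 := by
  intro k hk
  have h1 := h k hk
  rw [iteratedDerivWithin_fun_const_zero] at h1 ⊢
  refine squeeze_zero_norm (fun i => ?_) (by simpa using h1.norm)
  rw [iteratedDerivWithin_const_mul_field, norm_mul]
  exact mul_le_of_le_one_left (norm_nonneg _) (hc i)

end JetTendsto

theorem contDiffOn_inv_sqrt {I : Set ℝ} {f : ℝ → ℝ} (hf : ContDiffOn ℝ ∞ f I)
    (h : ∀ t ∈ I, 0 < f t) : ContDiffOn ℝ ∞ (fun s => (√(f s))⁻¹) I :=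
  (hf.sqrt fun t ht => (h t ht).ne').inv fun t ht => (Real.sqrt_pos.2 (h t ht)).ne'

/-- The differential equation `y' = -y³ f' / 2` for `y = f^(-1/2)`, written with products only so
that `JetTendsto.mul` applies in the induction on the order. -/
theorem derivWithin_inv_sqrt {I : Set ℝ} (hI : UniqueDiffOn ℝ I) {f : ℝ → ℝ}
    (hf : ContDiffOn ℝ ∞ f I) (h : ∀ t ∈ I, 0 < f t) :
    Set.EqOn (derivWithin (fun s => (√(f s))⁻¹) I)
      (fun s => ((√(f s))⁻¹ * ((√(f s))⁻¹ * (√(f s))⁻¹)) * ((-1 / 2) * derivWithin f I s)) I := by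
  intro t ht
  have hs := (Real.sqrt_pos.2 (h t ht)).ne'
  have h1 := (((hf.differentiableOn (by simp) t ht).hasDerivWithinAt.sqrt
    (h t ht).ne').fun_inv hs).derivWithin (hI t ht)
  rw [h1]
  field_simp

theorem JetTendsto.inv_sqrt {ι : Type*} {l : Filter ι} {I : Set ℝ} {K : ℕ} {T : ι → ℝ}
    {F : ι → ℝ → ℝ} {t₀ : ℝ} {f : ℝ → ℝ} (hI : UniqueDiffOn ℝ I) (hT : ∀ i, T i ∈ I)
    (ht₀ : t₀ ∈ I) (hTt : Tendsto T l (𝓝 t₀))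
    (hF : ∀ i, ContDiffOn ℝ ∞ (F i) I) (hf : ContDiffOn ℝ ∞ f I)
    (hF0 : ∀ i, ∀ t ∈ I, 0 < F i t) (hf0 : ∀ t ∈ I, 0 < f t) (h : JetTendsto l I K T F t₀ f) :
    JetTendsto l I K T (fun i s => (√(F i s))⁻¹) t₀ (fun s => (√(f s))⁻¹) := by
  have hY := fun i => contDiffOn_inv_sqrt (hF i) (hF0 i)
  have hy := contDiffOn_inv_sqrt hf hf0
  have hzero : Tendsto (fun i => (√(F i (T i)))⁻¹) l (𝓝 (√(f t₀))⁻¹) := by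
    have := h 0 (Nat.zero_le _)
    simp only [iteratedDerivWithin_zero] at this
    exact ((Real.continuous_sqrt.tendsto _).comp this).inv₀ (Real.sqrt_pos.2 (hf0 t₀ ht₀)).ne'
  induction K with
  | zero =>
    intro k hk
    obtain rfl : k = 0 := by omega
    simpa using hzero
  | succ K ih =>
    have hYK := ih (h.mono (Nat.le_succ K))
    have hdF : ∀ i, ContDiffOn ℝ ∞ (_root_.derivWithin (F i) I) I := fun i =>
      (hF i).derivWithin hI (by simp)
    have hdf : ContDiffOn ℝ ∞ (_root_.derivWithin f I) I := hf.derivWithin hI (by simp)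
    have h2 := hYK.mul hI hT ht₀ hY hY hy hy hYK
    have h3 := hYK.mul hI hT ht₀ hY (fun i => (hY i).mul (hY i)) hy (hy.mul hy) h2
    have h4 := (JetTendsto.const (K := K) hI hT ht₀ hTt
      (contDiffOn_const (c := (-1 / 2 : ℝ)))).mul hI hT ht₀ (fun _ => contDiffOn_const) hdF
      contDiffOn_const hdf h.derivWithin
    have h5 := h3.mul hI hT ht₀ (fun i => (hY i).mul ((hY i).mul (hY i)))
      (fun i => contDiffOn_const.mul (hdF i)) (hy.mul (hy.mul hy)) (contDiffOn_const.mul hdf) h4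
    exact .succ hzero (h5.congr hT ht₀ (fun i => derivWithin_inv_sqrt hI (hF i) (hF0 i))
      (derivWithin_inv_sqrt hI hf hf0))

/-! ### Perturbed pairs and their jets -/

open Filter Topology

theorem sum_coord_sq {I : Set ℝ} {p : ℕ} (τ : I → UnitSphere p) {t : ℝ} (ht : t ∈ I) :
    ∑ i, coord τ i t ^ 2 = 1 := by
  have h1 : ‖ext (toEuc τ) t‖ ^ 2 = 1 := by
    have := ext_apply (toEuc τ) ⟨t, ht⟩
    simp only at this
    rw [this]
    simp [toEuc]
  rw [EuclideanSpace.real_norm_sq_eq] at h1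
  exact h1

/-- Parameters of a perturbation of a pair `(a, τ)`: a smooth scaling function and coefficients,
together with a point of `I` at which the perturbation is observed. -/
structure Perturbation (I : Set ℝ) (p : ℕ) where
  ρ : ℝ → ℝ
  c : Fin (1 + p) → ℝ
  r : ℝ
  t : ℝ
  smooth : ContDiff ℝ ∞ ρ
  c_le : ∀ i, |c i| ≤ 1
  r_le : |r| ≤ 1
  mem : t ∈ I

namespace Perturbation

variable {I : Set ℝ} {p : ℕ}

/-- The perturbed coordinates before normalization. -/
noncomputable def dir (x : Perturbation I p) (τ : I → UnitSphere p) (i : Fin (1 + p)) (s : ℝ) : ℝ :=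
  coord τ i s + x.c i * (x.ρ s * (s ^ (i : ℕ) / (i : ℕ).factorial))

/-- The squared norm of the perturbed direction. -/
noncomputable def normSq (x : Perturbation I p) (τ : I → UnitSphere p) (s : ℝ) : ℝ :=
  ∑ i, x.dir τ i s * x.dir τ i s

/-- The coordinates of the perturbed map into the sphere. -/
noncomputable def newCoord (x : Perturbation I p) (τ : I → UnitSphere p) (i : Fin (1 + p))
    (s : ℝ) : ℝ :=
  (√(x.normSq τ s))⁻¹ * x.dir τ i s

/-- The perturbed coefficient function. -/
noncomputable def newCoeff (x : Perturbation I p) (a : I → ℝ) (s : ℝ) : ℝ :=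
  ext a s + x.r * x.ρ s

/-- The size of the `K`-jet of the scaling function at the point of observation plus the distance
of this point from `t₀`. -/
noncomputable def size (K : ℕ) (t₀ : ℝ) (x : Perturbation I p) : ℝ :=
  |x.t - t₀| + ∑ k ∈ Finset.range (K + 1), |iteratedDeriv k x.ρ x.t|

theorem contDiffOn_scaled (x : Perturbation I p) (i : Fin (1 + p)) :
    ContDiffOn ℝ ∞ (fun s => x.ρ s * (s ^ (i : ℕ) / (i : ℕ).factorial)) I :=
  (x.smooth.mul (by fun_prop)).contDiffOn

theorem contDiffOn_dir (x : Perturbation I p) {τ : I → UnitSphere p} (hτ : IsSmooth (toEuc τ))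
    (i : Fin (1 + p)) : ContDiffOn ℝ ∞ (x.dir τ i) I :=
  (contDiffOn_coord hτ i).add (contDiffOn_const.mul (x.contDiffOn_scaled i))

theorem contDiffOn_normSq (x : Perturbation I p) {τ : I → UnitSphere p}
    (hτ : IsSmooth (toEuc τ)) : ContDiffOn ℝ ∞ (x.normSq τ) I :=
  ContDiffOn.sum fun i _ => (x.contDiffOn_dir hτ i).mul (x.contDiffOn_dir hτ i)

theorem contDiffOn_newCoord (x : Perturbation I p) {τ : I → UnitSphere p}
    (hτ : IsSmooth (toEuc τ)) (h : ∀ s ∈ I, 0 < x.normSq τ s) (i : Fin (1 + p)) :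
    ContDiffOn ℝ ∞ (x.newCoord τ i) I :=
  (contDiffOn_inv_sqrt (x.contDiffOn_normSq hτ) h).mul (x.contDiffOn_dir hτ i)

theorem contDiffOn_newCoeff (x : Perturbation I p) {a : I → ℝ} (ha : IsSmooth a) :
    ContDiffOn ℝ ∞ (x.newCoeff a) I :=
  ContDiffOn.add ha (contDiff_const.mul x.smooth).contDiffOn

section Limits

variable {ι : Type*} {l : Filter ι} {K : ℕ} {t₀ : ℝ} {X : ι → Perturbation I p}

theorem tendsto_t (hX : Tendsto (fun i => size K t₀ (X i)) l (𝓝 0)) :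
    Tendsto (fun i => (X i).t) l (𝓝 t₀) := by
  rw [tendsto_iff_norm_sub_tendsto_zero]
  refine squeeze_zero (fun _ => norm_nonneg _) (fun i => ?_) hX
  exact le_add_of_nonneg_right (Finset.sum_nonneg fun _ _ => abs_nonneg _)

theorem jetTendsto_ρ (hI : UniqueDiffOn ℝ I) (hX : Tendsto (fun i => size K t₀ (X i)) l (𝓝 0)) :
    JetTendsto l I K (fun i => (X i).t) (fun i => (X i).ρ) t₀ fun _ => 0 := by
  intro k hk
  rw [iteratedDerivWithin_fun_const_zero]
  refine squeeze_zero_norm (fun i => ?_) hX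
  rw [iteratedDerivWithin_eq_iteratedDeriv hI
    (((X i).smooth.of_le (by exact_mod_cast le_top)).contDiffAt) (X i).mem]
  refine le_add_of_nonneg_of_le (abs_nonneg _) ?_
  exact Finset.single_le_sum (f := fun k => |iteratedDeriv k (X i).ρ (X i).t|)
    (fun _ _ => abs_nonneg _) (Finset.mem_range.2 (by omega))

theorem jetTendsto_dir (hI : UniqueDiffOn ℝ I) (ht₀ : t₀ ∈ I)
    (hX : Tendsto (fun i => size K t₀ (X i)) l (𝓝 0)) {τ : I → UnitSphere p}
    (hτ : IsSmooth (toEuc τ)) (j : Fin (1 + p)) :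
    JetTendsto l I K (fun i => (X i).t) (fun i => (X i).dir τ j) t₀ (coord τ j) := by
  have hmem : ∀ i, (X i).t ∈ I := fun i => (X i).mem
  have hpow : ContDiffOn ℝ ∞ (fun s : ℝ => s ^ (j : ℕ) / ((j : ℕ).factorial : ℝ)) I :=
    ContDiff.contDiffOn (by fun_prop)
  have h1 := (jetTendsto_ρ hI hX).mul hI hmem ht₀ (fun i => (X i).smooth.contDiffOn)
    (fun _ => hpow) contDiffOn_const hpow (.const hI hmem ht₀ (tendsto_t hX) hpow)
  simp only [zero_mul] at h1
  have h2 := h1.bounded_const_mul (c := fun i => (X i).c j) fun i => (X i).c_le j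
  have h3 := (JetTendsto.const (K := K) hI hmem ht₀ (tendsto_t hX) (contDiffOn_coord hτ j)).add
    hI hmem ht₀ (fun _ => contDiffOn_coord hτ j)
    (fun i => contDiffOn_const.mul ((X i).contDiffOn_scaled j)) (contDiffOn_coord hτ j)
    contDiffOn_const h2
  simp only [add_zero] at h3
  exact h3

theorem jetTendsto_normSq (hI : UniqueDiffOn ℝ I) (ht₀ : t₀ ∈ I)
    (hX : Tendsto (fun i => size K t₀ (X i)) l (𝓝 0)) {τ : I → UnitSphere p}
    (hτ : IsSmooth (toEuc τ)) :
    JetTendsto l I K (fun i => (X i).t) (fun i => (X i).normSq τ) t₀ fun _ => 1 := by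
  have hmem : ∀ i, (X i).t ∈ I := fun i => (X i).mem
  have h1 := JetTendsto.sum Finset.univ hI hmem ht₀
    (fun j i => ((X i).contDiffOn_dir hτ j).mul ((X i).contDiffOn_dir hτ j))
    (fun j => (contDiffOn_coord hτ j).mul (contDiffOn_coord hτ j))
    fun j => (jetTendsto_dir hI ht₀ hX hτ j).mul hI hmem ht₀
      (fun i => (X i).contDiffOn_dir hτ j) (fun i => (X i).contDiffOn_dir hτ j)
      (contDiffOn_coord hτ j) (contDiffOn_coord hτ j) (jetTendsto_dir hI ht₀ hX hτ j)
  refine h1.congr hmem ht₀ (fun i s _ => rfl) fun s hs => ?_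
  rw [← sum_coord_sq τ hs]
  exact Finset.sum_congr rfl fun j _ => sq _

theorem jetTendsto_newCoord (hI : UniqueDiffOn ℝ I) (ht₀ : t₀ ∈ I)
    (hX : Tendsto (fun i => size K t₀ (X i)) l (𝓝 0)) {τ : I → UnitSphere p}
    (hτ : IsSmooth (toEuc τ)) (hpos : ∀ i, ∀ s ∈ I, 0 < (X i).normSq τ s) (j : Fin (1 + p)) :
    JetTendsto l I K (fun i => (X i).t) (fun i => (X i).newCoord τ j) t₀ (coord τ j) := by
  have hmem : ∀ i, (X i).t ∈ I := fun i => (X i).mem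
  have h1 := (jetTendsto_normSq hI ht₀ hX hτ).inv_sqrt hI hmem ht₀ (tendsto_t hX)
    (fun i => (X i).contDiffOn_normSq hτ) contDiffOn_const hpos fun _ _ => one_pos
  have h2 := h1.mul hI hmem ht₀
    (fun i => contDiffOn_inv_sqrt ((X i).contDiffOn_normSq hτ) (hpos i))
    (fun i => (X i).contDiffOn_dir hτ j) contDiffOn_const (contDiffOn_coord hτ j)
    (jetTendsto_dir hI ht₀ hX hτ j)
  simp only [Real.sqrt_one, inv_one, one_mul] at h2
  exact h2

theorem jetTendsto_newCoeff (hI : UniqueDiffOn ℝ I) (ht₀ : t₀ ∈ I)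
    (hX : Tendsto (fun i => size K t₀ (X i)) l (𝓝 0)) {a : I → ℝ} (ha : IsSmooth a) :
    JetTendsto l I K (fun i => (X i).t) (fun i => (X i).newCoeff a) t₀ (ext a) := by
  have hmem : ∀ i, (X i).t ∈ I := fun i => (X i).mem
  have h1 := (JetTendsto.const (K := K) hI hmem ht₀ (tendsto_t hX) ha).add hI hmem ht₀
    (fun _ => ha) (fun i => contDiffOn_const.mul (X i).smooth.contDiffOn) ha contDiffOn_const
    ((jetTendsto_ρ hI hX).bounded_const_mul (c := fun i => (X i).r) fun i => (X i).r_le)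
  simp only [add_zero] at h1
  exact h1

end Limits

/-- Taking the perturbations themselves as index set, with the filter of small size, turns limit
theorems into estimates uniform in the perturbation. -/
theorem exists_of_eventually_size {J : Type*} (φ : J → ℝ) {P : J → Prop}
    (h : ∀ᶠ x in comap φ (𝓝 0), P x) : ∃ η > 0, ∀ x, |φ x| < η → P x := by
  obtain ⟨η, hη, h1⟩ := Metric.eventually_nhds_iff.1 (eventually_comap.1 h)
  exact ⟨η, hη, fun x hx => h1 (by simpa using hx) x rfl⟩

theorem exists_size_normSq_pos (hI : UniqueDiffOn ℝ I) {τ : I → UnitSphere p}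
    (hτ : IsSmooth (toEuc τ)) (K : ℕ) {t₀ : ℝ} (ht₀ : t₀ ∈ I) :
    ∃ η > 0, ∀ x : Perturbation I p, |size K t₀ x| < η → 0 < x.normSq τ x.t := by
  refine exists_of_eventually_size _ ?_
  have h := jetTendsto_normSq (X := id) hI ht₀ (tendsto_comap : Tendsto (size K t₀) _ _) hτ 0
    (Nat.zero_le _)
  simp only [iteratedDerivWithin_zero, id] at h
  exact h.eventually_const_lt one_pos

theorem exists_size_jet_close (hI : UniqueDiffOn ℝ I) (g : SmoothPair I p) (K : ℕ) {t₀ : ℝ}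
    (ht₀ : t₀ ∈ I) {δ : ℝ} (hδ : 0 < δ) :
    ∃ η > 0, ∀ x : Perturbation I p, (∀ s ∈ I, 0 < x.normSq g.τ s) → |size K t₀ x| < η →
      |x.t - t₀| < δ ∧ ∀ k ≤ K,
        dist (iteratedDerivWithin k (x.newCoeff g.a) I x.t)
          (iteratedDerivWithin k (ext g.a) I t₀) < δ ∧
        dist (WithLp.toLp 2 fun i => iteratedDerivWithin k (x.newCoord g.τ i) I x.t : Euc p)
          (WithLp.toLp 2 fun i => iteratedDerivWithin k (coord g.τ i) I t₀) < δ := by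
  -- Normalization is smooth only if `normSq` is positive on all of `I`, so the limit is taken over
  -- such perturbations.
  let J := {x : Perturbation I p // ∀ s ∈ I, 0 < x.normSq g.τ s}
  suffices h : ∃ η > 0, ∀ x : J, |size K t₀ x.1| < η → |x.1.t - t₀| < δ ∧ ∀ k ∈ Finset.range (K + 1),
        dist (iteratedDerivWithin k (x.1.newCoeff g.a) I x.1.t)
          (iteratedDerivWithin k (ext g.a) I t₀) < δ ∧
        dist (WithLp.toLp 2 fun i => iteratedDerivWithin k (x.1.newCoord g.τ i) I x.1.t : Euc p)
          (WithLp.toLp 2 fun i => iteratedDerivWithin k (coord g.τ i) I t₀) < δ by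
    obtain ⟨η, hη, h⟩ := h
    refine ⟨η, hη, fun x hx hs => ⟨(h ⟨x, hx⟩ hs).1, fun k hk => (h ⟨x, hx⟩ hs).2 k ?_⟩⟩
    exact Finset.mem_range.2 (by omega)
  refine exists_of_eventually_size (fun x : J => size K t₀ x.1) ?_
  have hX : Tendsto (fun x : J => size K t₀ x.1) (comap (fun x : J => size K t₀ x.1) (𝓝 0)) (𝓝 0) :=
    tendsto_comap
  refine Eventually.and ?_ ((Finset.eventually_all _).2 fun k hk => Eventually.and ?_ ?_)
  · exact Metric.tendsto_nhds.1 (tendsto_t hX) δ hδ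
  · exact Metric.tendsto_nhds.1
      (jetTendsto_newCoeff hI ht₀ hX g.smooth_a k (by simpa [Nat.lt_succ_iff] using hk)) δ hδ
  · refine Metric.tendsto_nhds.1 (((PiLp.continuous_toLp 2 _).tendsto _).comp
      (tendsto_pi_nhds.2 fun i => ?_)) δ hδ
    exact jetTendsto_newCoord hI ht₀ hX g.smooth_τ (fun x => x.2) i k
      (by simpa [Nat.lt_succ_iff] using hk)

end Perturbation

/-! ### Openness and density in the Whitney topology -/

/-- Open sets of the Whitney topology contain basic neighbourhoods given by local bounds on the
derivatives up to some fixed order. -/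
theorem exists_local_bounds_of_isOpen {I : Set ℝ} {p : ℕ} {M : Set (SmoothPair I p)}
    (hM : IsOpen M) {g₀ : SmoothPair I p} (hg₀ : g₀ ∈ M) :
    ∃ (K : ℕ) (δ : I → ℝ), (∀ s, 0 < δ s) ∧ ∀ g : SmoothPair I p,
      (∀ t : I, ∃ s : I, |(t : ℝ) - s| < δ s ∧ ∀ k ≤ K, dist (D k g.a t) (D k g₀.a s) < δ s ∧
        dist (D k (toEuc g.τ) t) (D k (toEuc g₀.τ) s) < δ s) → g ∈ M := by
  have hM' : TopologicalSpace.GenerateOpen _ M := hM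
  induction hM' with
  | basic M hb =>
    obtain ⟨k, U, hU, rfl⟩ := hb
    have h1 : ∀ s : I, ∃ ε > 0, Metric.ball (g₀.jet k s) ε ⊆ U := fun s =>
      Metric.isOpen_iff.1 hU _ (hg₀ s)
    choose δ hδ hball using h1
    refine ⟨k, δ, hδ, fun g hg t => ?_⟩
    obtain ⟨s, hs, hj⟩ := hg t
    refine hball s ?_
    rw [Metric.mem_ball, Prod.dist_eq, max_lt_iff, dist_pi_lt_iff (hδ s)]
    refine ⟨hs, fun j => ?_⟩
    rw [Prod.dist_eq, max_lt_iff]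
    exact hj j (by omega)
  | univ => exact ⟨0, fun _ => 1, fun _ => one_pos, fun _ _ => trivial⟩
  | inter A B hA hB ihA ihB =>
    obtain ⟨K₁, δ₁, hδ₁, h₁⟩ := ihA hA hg₀.1
    obtain ⟨K₂, δ₂, hδ₂, h₂⟩ := ihB hB hg₀.2
    refine ⟨max K₁ K₂, fun s => min (δ₁ s) (δ₂ s), fun s => lt_min (hδ₁ s) (hδ₂ s),
      fun g hg => ⟨h₁ g fun t => ?_, h₂ g fun t => ?_⟩⟩
    · obtain ⟨s, hs, hj⟩ := hg t
      refine ⟨s, hs.trans_le (min_le_left _ _), fun k hk => ?_⟩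
      have := hj k (le_max_of_le_left hk)
      exact ⟨this.1.trans_le (min_le_left _ _), this.2.trans_le (min_le_left _ _)⟩
    · obtain ⟨s, hs, hj⟩ := hg t
      refine ⟨s, hs.trans_le (min_le_right _ _), fun k hk => ?_⟩
      have := hj k (le_max_of_le_right hk)
      exact ⟨this.1.trans_le (min_le_right _ _), this.2.trans_le (min_le_right _ _)⟩
  | sUnion S hS ih =>
    obtain ⟨A, hA, hgA⟩ := hg₀
    obtain ⟨K, δ, hδ, h⟩ := ih A hA (hS A hA) hgA
    exact ⟨K, δ, hδ, fun g hg => ⟨A, hA, h g hg⟩⟩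

/-- The pair obtained from `g` by a perturbation. -/
noncomputable def Perturbation.apply {I : Set ℝ} {p : ℕ} (x : Perturbation I p)
    (g : SmoothPair I p) (h : ∀ s ∈ I, 0 < x.normSq g.τ s) : SmoothPair I p where
  a t := x.newCoeff g.a t
  τ t := ⟨WithLp.toLp 2 fun i => x.newCoord g.τ i t, by
    rw [mem_sphere_zero_iff_norm, ← sq_eq_sq₀ (norm_nonneg _) zero_le_one,
      EuclideanSpace.real_norm_sq_eq]
    simp only [newCoord, mul_pow, ← Finset.mul_sum, inv_pow, one_pow]
    rw [Real.sq_sqrt (h t t.2).le]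
    simp only [normSq, ← sq]
    have := (h t t.2).ne'
    simp only [normSq, ← sq] at this
    exact inv_mul_cancel₀ this⟩
  smooth_a := (x.contDiffOn_newCoeff g.smooth_a).congr fun s hs =>
    ext_apply (fun t : I => x.newCoeff g.a t) ⟨s, hs⟩
  smooth_τ := by
    have h1 : ContDiffOn ℝ ∞ (fun s => (WithLp.toLp 2 fun i => x.newCoord g.τ i s : Euc p)) I :=
      contDiffOn_piLp' (p := 2) fun i => x.contDiffOn_newCoord g.smooth_τ h i
    exact h1.congr fun s hs => ext_apply (toEuc _) ⟨s, hs⟩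

/-- The degeneracy and its derivative at `t` are continuous functions of the `(1+p)`-jet, and the
condition says that they do not both vanish. -/
theorem isOpen_noDoubleZero {I : Set ℝ} (hI : UniqueDiffOn ℝ I) (p : ℕ) :
    IsOpen {g : SmoothPair I p | NoDoubleZero I (degeneracy g)} := by
  let δ : (Fin (1 + p + 1) → ℝ × Euc p) → ℝ := fun J =>
    (Matrix.of fun i j : Fin (1 + p) => (J j.castSucc).2 i).det
  let δ' : (Fin (1 + p + 1) → ℝ × Euc p) → ℝ := fun J =>
    (Matrix.of fun i j : Fin (1 + p) =>
      (J ⟨if (j : ℕ) + 1 = 1 + p then 1 + p else j, by split_ifs <;> omega⟩).2 i).det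
  have hδ : Continuous δ := Continuous.matrix_det (by fun_prop)
  have hδ' : Continuous δ' := Continuous.matrix_det (by fun_prop)
  refine TopologicalSpace.isOpen_generateFrom_of_mem ⟨1 + p,
    {x | (x.2 0).1 * δ x.2 ≠ 0 ∨ (x.2 1).1 * δ x.2 + (x.2 0).1 * δ' x.2 ≠ 0}, ?_, ?_⟩
  · refine (isOpen_ne_fun ?_ continuous_const).union (isOpen_ne_fun ?_ continuous_const)
    · fun_prop
    · fun_prop
  · ext g
    simp only [Set.mem_ofPred_eq]
    refine Iff.trans ?_ (Subtype.forall (p := (· ∈ I))).symm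
    refine forall₂_congr fun t ht => ?_
    have h1 : δ (g.jet (1 + p) ⟨t, ht⟩).2 = wronskianDet I (coord g.τ) t := by
      simp only [δ, wronskianDet, SmoothPair.jet, D]
      congr 1
      ext i j
      exact (iteratedDerivWithin_euc_apply hI g.smooth_τ j ht i).symm
    have h2 : δ' (g.jet (1 + p) ⟨t, ht⟩).2 = wronskianDetNext I (coord g.τ) t := by
      simp only [δ', wronskianDetNext, SmoothPair.jet, D]
      congr 1
      ext i j
      exact (iteratedDerivWithin_euc_apply hI g.smooth_τ _ ht i).symm
    have h3 : ((g.jet (1 + p) ⟨t, ht⟩).2 0).1 = ext g.a t := by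
      simp [SmoothPair.jet, D]
    have h4 : ((g.jet (1 + p) ⟨t, ht⟩).2 1).1 = derivWithin (ext g.a) I t := by
      have : 1 % (1 + p + 1) = 1 := Nat.mod_eq_of_lt (by omega)
      simp [SmoothPair.jet, D, this, iteratedDerivWithin_one]
    rw [h1, h2, h3, h4, derivWithin_degeneracy hI g ht, degeneracy]
    exact imp_iff_not_or

theorem dense_noDoubleZero {I : Set ℝ} (hI : UniqueDiffOn ℝ I) (p : ℕ) :
    Dense {g : SmoothPair I p | NoDoubleZero I (degeneracy g)} := by
  rw [dense_iff_inter_open]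
  rintro M hM ⟨g₀, hg₀⟩
  obtain ⟨K, δ, hδ, hclose⟩ := exists_local_bounds_of_isOpen hM hg₀
  have h1 : ∀ s : ℝ, ∃ η : ℝ, ∀ hs : s ∈ I, 0 < η ∧ ∀ x : Perturbation I p,
      |x.size K s| < η → 0 < x.normSq g₀.τ x.t ∧ ((∀ s ∈ I, 0 < x.normSq g₀.τ s) →
        |x.t - s| < δ ⟨s, hs⟩ ∧ ∀ k ≤ K,
        dist (iteratedDerivWithin k (x.newCoeff g₀.a) I x.t)
          (iteratedDerivWithin k (ext g₀.a) I s) < δ ⟨s, hs⟩ ∧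
        dist (WithLp.toLp 2 fun i => iteratedDerivWithin k (x.newCoord g₀.τ i) I x.t : Euc p)
          (WithLp.toLp 2 fun i => iteratedDerivWithin k (coord g₀.τ i) I s) < δ ⟨s, hs⟩) := by
    intro s
    by_cases hs : s ∈ I
    · obtain ⟨η₁, hη₁, h1⟩ := Perturbation.exists_size_normSq_pos hI g₀.smooth_τ K hs
      obtain ⟨η₂, hη₂, h2⟩ := Perturbation.exists_size_jet_close hI g₀ K hs (hδ ⟨s, hs⟩)
      exact ⟨min η₁ η₂, fun _ => ⟨lt_min hη₁ hη₂, fun x hx =>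
        ⟨h1 x (hx.trans_le (min_le_left _ _)), fun hpos =>
          h2 x hpos (hx.trans_le (min_le_right _ _))⟩⟩⟩
    · exact ⟨0, fun h => absurd h hs⟩
  -- The size is a sum of `K + 2` terms, each below `η s / (K + 3)`.
  choose η hη using h1
  obtain ⟨ρ, hρ, hρ0, hρs⟩ := exists_contDiff_pos_small (I := I) K (fun s => η s / (K + 3))
    fun s hs => div_pos (hη s hs).1 (by positivity)
  -- Dividing by `ρ` turns the scaled perturbations `c i * ρ * t^i / i!` and `r * ρ` into the
  -- unscaled ones of the Sard argument.
  have hu : ∀ i, ContDiffOn ℝ ∞ (fun s => coord g₀.τ i s / ρ s) I := fun i =>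
    (contDiffOn_coord g₀.smooth_τ i).div hρ.contDiffOn fun s hs => (hρ0 s hs).ne'
  obtain ⟨c, hc, hnd⟩ := exists_wronskianDet_noDoubleZero hI one_pos (1 + p) _ hu
  set E := wronskianDet I fun i t => coord g₀.τ i t / ρ t + c i * (t ^ (i : ℕ) / (i : ℕ).factorial)
    with hEdef
  have hus : ∀ i : Fin (1 + p), ContDiffOn ℝ ∞
      (fun t => coord g₀.τ i t / ρ t + c i * (t ^ (i : ℕ) / (i : ℕ).factorial)) I := fun i =>
    (hu i).add (ContDiff.contDiffOn (by fun_prop))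
  have hE : DifferentiableOn ℝ E I := differentiableOn_wronskianDet hI hus
  have ha : ContDiffOn ℝ ∞ (fun s => ext g₀.a s / ρ s) I :=
    ContDiffOn.div g₀.smooth_a hρ.contDiffOn fun s hs => (hρ0 s hs).ne'
  have had : DifferentiableOn ℝ (fun s => ext g₀.a s / ρ s * E s) I :=
    (ha.differentiableOn (by simp)).mul hE
  obtain ⟨r, hr, hnd'⟩ := hnd.exists_perturbation had hE hI one_pos
  -- One perturbation observed at varying points: the perturbed functions do not depend on `t`, so
  -- any `t₁` represents it.
  let x : I → Perturbation I p := fun t => ⟨ρ, c, r, t, hρ, fun i => (hc i).le, hr.le, t.2⟩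
  have hsize : ∀ t : I, ∃ s ∈ I, |(x t).size K s| < η s := by
    intro t
    obtain ⟨s, hs, h1, h2⟩ := hρs t t.2
    refine ⟨s, hs, ?_⟩
    have h3 : 0 < η s / (K + 3) := (abs_nonneg _).trans_lt h1
    have h4 : ∑ k ∈ Finset.range (K + 1), |iteratedDeriv k ρ t| ≤ (K + 1) * (η s / (K + 3)) := by
      have := Finset.sum_le_card_nsmul (Finset.range (K + 1)) (fun k => |iteratedDeriv k ρ t|)
        (η s / (K + 3)) fun k hk => (h2 k (by simpa [Nat.lt_succ_iff] using hk)).le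
      simpa using this
    have h5 : (K + 3) * (η s / (K + 3)) = η s := mul_div_cancel₀ _ (by positivity)
    rw [Perturbation.size, abs_of_nonneg
      (add_nonneg (abs_nonneg _) (Finset.sum_nonneg fun _ _ => abs_nonneg _))]
    change |(t : ℝ) - s| + ∑ k ∈ Finset.range (K + 1), |iteratedDeriv k ρ t| < η s
    linarith
  obtain hemp | ⟨⟨t₁⟩⟩ := isEmpty_or_nonempty I
  · exact ⟨g₀, hg₀, fun t ht => (hemp.false ⟨t, ht⟩).elim⟩
  have hpos : ∀ s ∈ I, 0 < (x t₁).normSq g₀.τ s := by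
    intro t ht
    obtain ⟨s, hs, h1⟩ := hsize ⟨t, ht⟩
    exact ((hη s hs).2 _ h1).1
  have hcoeff : ∀ s ∈ I, ext ((x t₁).apply g₀ hpos).a s = (x t₁).newCoeff g₀.a s :=
    fun s hs => ext_apply _ ⟨s, hs⟩
  have hcoord : ∀ i, ∀ s ∈ I, coord ((x t₁).apply g₀ hpos).τ i s = (x t₁).newCoord g₀.τ i s :=
    fun i s hs => congrArg (fun y : Euc p => y i) (ext_apply (toEuc _) ⟨s, hs⟩)
  have hvec : ∀ (g : SmoothPair I p) (k : ℕ) (t : I), D k (toEuc g.τ) t =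
      WithLp.toLp 2 fun i => iteratedDerivWithin k (coord g.τ i) I t := by
    intro g k t
    ext i
    exact (iteratedDerivWithin_euc_apply hI g.smooth_τ k t.2 i).symm
  refine ⟨(x t₁).apply g₀ hpos, hclose _ fun t => ?_, ?_⟩
  · obtain ⟨s, hs, h1⟩ := hsize t
    obtain ⟨h2, h3⟩ := ((hη s hs).2 _ h1).2 hpos
    refine ⟨⟨s, hs⟩, h2, fun k hk => ⟨?_, ?_⟩⟩
    · have := (h3 k hk).1
      rw [D, iteratedDerivWithin_congr hcoeff t.2]
      exact this
    · rw [hvec, hvec]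
      simp only [iteratedDerivWithin_congr (hcoord _) t.2]
      exact (h3 k hk).2
  -- The new degeneracy is `ρ l^(1+p) ((a/ρ) E + r E)`, a nowhere vanishing multiple of a function
  -- with simple zeros.
  · set l : ℝ → ℝ := fun s => (√((x t₁).normSq g₀.τ s))⁻¹ * ρ s with hl
    have hls : ContDiffOn ℝ ∞ l I := (contDiffOn_inv_sqrt
      ((x t₁).contDiffOn_normSq g₀.smooth_τ) hpos).mul hρ.contDiffOn
    have hl0 : ∀ s ∈ I, l s ≠ 0 := fun s hs =>
      mul_ne_zero (inv_ne_zero (Real.sqrt_pos.2 (hpos s hs)).ne') (hρ0 s hs).ne'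
    have hw : ∀ t ∈ I, wronskianDet I (coord ((x t₁).apply g₀ hpos).τ) t = l t ^ (1 + p) * E t := by
      intro t ht
      refine wronskianDet_mul hI hus hls (fun i s hs => ?_) ht
      have := (hρ0 s hs).ne'
      rw [hcoord i s hs, Perturbation.newCoord, Perturbation.dir, hl]
      simp only [x]
      field_simp
    refine (hnd'.mul_left hI (had.fun_add (hE.const_mul r)) (l := fun s => ρ s * l s ^ (1 + p))
      ((hρ.contDiffOn.mul (hls.pow _)).differentiableOn (by simp)) fun s hs =>
        mul_ne_zero (hρ0 s hs).ne' (pow_ne_zero _ (hl0 s hs))).congr fun s hs => ?_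
    have := (hρ0 s hs).ne'
    rw [degeneracy, hw s hs, hcoeff s hs, Perturbation.newCoeff]
    simp only [x]
    field_simp

end FrontalCurve

theorem proposition3p3 (p : ℕ) (hp : 2 ≤ p) (I : Set ℝ) (hI : I.OrdConnected)
    (hI' : (interior I).Nonempty) :
    FrontalCurve.GenericFrontalCurvesSatisfy I p (fun f =>
      (∀ t : I, ¬ FrontalCurve.IsInflectionPoint f t) ∧
      ∀ t : I, FrontalCurve.HasType f t (FrontalCurve.typeRegular p) ∨
        FrontalCurve.HasType f t (FrontalCurve.typeFlat p) ∨
        FrontalCurve.HasType f t (FrontalCurve.typeCuspidal p)) := by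
  have hU : UniqueDiffOn ℝ I := uniqueDiffOn_convex hI.convex hI'
  refine ⟨{g | FrontalCurve.NoDoubleZero I (FrontalCurve.degeneracy g)},
    FrontalCurve.isOpen_noDoubleZero hU p, FrontalCurve.dense_noDoubleZero hU p, ?_⟩
  rintro f ⟨hf, g, hg, hfg⟩
  exact ⟨FrontalCurve.not_isInflectionPoint_of_noDoubleZero hU hp hfg hg,
    FrontalCurve.hasType_of_noDoubleZero hU hf.1 hfg hg⟩
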